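/- Let $\mathcal B$ be a $C^*$-algebra (not necessarily unital) and $k\ge 0$ an integer, $I_k=\{1,\dots,k\}$. Let $\mathbb E$ be a product system over $\mathbb N_0^k$: it is given by $C^*$-correspondences $E_1,\dots,E_k$ over $\mathcal B$ and unitary isomorphisms of correspondences $t_{i,j}:E_i\otimes_{\mathcal B} E_j\to E_j\otimes_{\mathcal B} E_i$ $(i,j\in I_k)$ with $t_{i,i}=\mathrm{id}$ and $t_{j,i}=t_{i,j}^{-1}$. For $\mathbf n=(n_1,\dots,n_k)\in\mathbb N_0^k$ put $\mathbb E(\mathbf n)=E_1^{\otimes n_1}\otimes\cdots\otimes E_k^{\otimes n_k}$; for a representation of $\mathcal B$ on a Hilbert space $\mathcal K$, we set $\mathbb E(\mathbf 0)\otimes\mathcal K:=\mathcal K$. All tensor products are (completed) interior tensor products. Let $(\sigma,V^{(1)},\dots,V^{(k)})$ be a completely contractive covariant representation of $\mathbb E$ on a Hilbert space $\mathcal H_V$: $\sigma:\mathcal B\to B(\mathcal H_V)$ is a $*$-homomorphism, each $V^{(i)}:E_i\to B(\mathcal H_V)$ is linear and completely contractive with $V^{(i)}(a\xi)=\sigma(a)V^{(i)}(\xi)$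 and $V^{(i)}(\xi b)=V^{(i)}(\xi)\sigma(b)$, and the contractions $\widetilde V^{(i)}:E_i\otimes_\sigma\mathcal H_V\to\mathcal H_V$, $\widetilde V^{(i)}(\xi\otimes h)=V^{(i)}(\xi)h$, satisfy $$\widetilde V^{(i)}(I_{E_i}\otimes\widetilde V^{(j)})=\widetilde V^{(j)}(I_{E_j}\otimes\widetilde V^{(i)})(t_{i,j}\otimes I_{\mathcal H_V})\qquad(i,j\in I_k).$$ For $\mathbf n\in\mathbb N_0^k$ let $\widetilde V_{\mathbf n}:\mathbb E(\mathbf n)\otimes_\sigma\mathcal H_V\to\mathcal H_V$ be the composite of the operators $\widetilde V^{(i)}$ (amplified by identities) along the factors of $\mathbb E(\mathbf n)$, and let $$\widetilde V_{\mathbf n}^{\,p}=\widetilde V_{\mathbf n}(I_{\mathbb E(\mathbf n)}\otimes\widetilde V_{\mathbf n})\cdots(I_{\mathbb E(\mathbf n)^{\otimes (p-1)}}\otimes\widetilde V_{\mathbf n}):\mathbb E(\mathbf n)^{\otimes p}\otimes_\sigma\mathcal H_V\to\mathcal H_V ,\qquad \widetilde V_{\mathbf n}^{*p}:=(\widetilde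 V_{\mathbf n}^{\,p})^*$$ be its $p$-th generalized power. For $u\subseteq I_k$ let $\mathbf e(u)\in\{0,1\}^k$ be the indicator of $u$ and $|u|$ its cardinality. Assume the Brehmer–Solel condition $$\sum_{u\subseteq I_k}(-1)^{|u|}\,\widetilde V_{\mathbf e(u)}\widetilde V_{\mathbf e(u)}^{*}\ \ge 0 ,$$ and put $\Delta_*(V)=\big(\sum_{u\subseteq I_k}(-1)^{|u|}\widetilde V_{\mathbf e(u)}\widetilde V_{\mathbf e(u)}^{*}\big)^{1/2}$ and $\mathcal D_{*,V}=\overline{\Delta_*(V)\mathcal H_V}$. The operator $\Delta_*(V)$ commutes with $\sigma(\mathcal B)$; let $\pi$ be the restriction of $\sigma$ to $\mathcal D_{*,V}$. Let $\mathcal F(\mathbb E)\otimes_\pi\mathcal D_{*,V}=\bigoplus_{\mathbf n\in\mathbb N_0^k}\mathbb E(\mathbf n)\otimes_\pi\mathcal D_{*,V}$ carry the induced representation $(\rho,S^{(1)},\dots,S^{(k)})$ of $\mathbb E$: $\rho(a)$ is the diagonal left action of $a\in\mathcal B$, and $S^{(i)}(\xi)\eta=\xi\otimes\eta$ for $\xi\in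 E_i$, where $E_i\otimes\mathbb E(\mathbf n)$ is identified with $\mathbb E(\mathbf n+\mathbf e_i)$ by means of the isomorphisms $t_{i,j}$ ($\mathbf e_i$ being the $i$-th unit multi-index); let $\widetilde S^{(i)}(\xi\otimes\eta)=S^{(i)}(\xi)\eta$. Then there is a bounded operator $\Pi_V:\mathcal H_V\to\mathcal F(\mathbb E)\otimes_\pi\mathcal D_{*,V}$ whose component in $\mathbb E(\mathbf n)\otimes_\pi\mathcal D_{*,V}$ is $$\Pi_V^{\mathbf n}=(I_{\mathbb E(\mathbf n)}\otimes\Delta_*(V))\,\widetilde V_{\mathbf n}^{*}\qquad(\mathbf n\in\mathbb N_0^k),$$ and it satisfies $$\Pi_V\sigma(a)=\rho(a)\Pi_V\quad(a\in\mathcal B),\qquad (I_{E_i}\otimes\Pi_V)\widetilde V^{(i)*}=\widetilde S^{(i)*}\Pi_V\quad(i\in I_k).$$ Moreover, for every $h\in\mathcal H_V$ the following limits exist and $$\|\Pi_Vh\|^2=\lim_{p\to\infty}\sum_{u\subseteq I_k}(-1)^{|u|}\big\|\widetilde V_{\mathbf e(u)}^{*p}h\big\|^2=\|h\|^2+\lim_{p\to\infty}\sum_{\emptyset\ne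 u\subseteq I_k}(-1)^{|u|}\big\|\widetilde V_{\mathbf e(u)}^{*p}h\big\|^2 .$$ -/

import Mathlib

open scoped TensorProduct ComplexOrder InnerProductSpace
open Filter Topology

universe w u

noncomputable section

namespace BrehmerSolel

/-! ### Semi-inner-product bimodules -/

/-- An `A`-`C` pre-correspondence: a complex vector space `P` with a `C`-valued semi-inner product
(conjugate-linear in the first variable), a right action of `C` and a left action of `A` by
adjointable maps.  No definiteness or completeness is required. -/
structure PreCorr (A : Type*) (C : Type*) [NonUnitalCStarAlgebra A] [NonUnitalCStarAlgebra C]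
    [PartialOrder C] [StarOrderedRing C] (P : Type*) [AddCommGroup P] [Module ℂ P] where
  form : P →ₗ⋆[ℂ] P →ₗ[ℂ] C
  nonneg : ∀ x, 0 ≤ form x x
  symm : ∀ x y, star (form x y) = form y x
  ract : C → P →ₗ[ℂ] P
  form_ract : ∀ x y c, form x (ract c y) = form x y * c
  lact : A →ₙₐ[ℂ] Module.End ℂ P
  form_lact : ∀ a x y, form (lact a x) y = form x (lact (star a) y)

namespace PreCorr

variable {A : Type*} {C : Type*} [NonUnitalCStarAlgebra A] [NonUnitalCStarAlgebra C]
    [PartialOrder C] [StarOrderedRing C] {P : Type*} [AddCommGroup P] [Module ℂ P]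

lemma form_ract_left (p : PreCorr A C P) (x y : P) (c : C) :
    p.form (p.ract c x) y = star c * p.form x y := by
  rw [← p.symm, p.form_ract, star_mul, p.symm]

lemma norm_form_le (p : PreCorr A C P) (x y : P) :
    ‖p.form x y‖ ^ 2 ≤ ‖p.form x x‖ * ‖p.form y y‖ := by
  have key : ∀ s : ℝ, ‖p.form x x‖ < s → ‖p.form x y‖ ^ 2 ≤ s * ‖p.form y y‖ := by
    intro s hs
    have hs0 : 0 < s := lt_of_le_of_lt (norm_nonneg _) hs
    set a := p.form x y with ha
    have hyx : p.form y x = star a := by rw [ha, p.symm]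
    have h0 : 0 ≤ p.form (p.ract a x - (s : ℂ) • y) (p.ract a x - (s : ℂ) • y) := p.nonneg _
    have h1 : p.form (p.ract a x - (s : ℂ) • y) (p.ract a x - (s : ℂ) • y)
        = star a * p.form x x * a - s • (star a * a) - s • (star a * a)
          + s • (s • p.form y y) := by
      simp only [map_sub, LinearMap.sub_apply, map_smul, LinearMap.map_smulₛₗ,
        LinearMap.smul_apply, p.form_ract, p.form_ract_left, hyx, ← ha, Complex.conj_ofReal,
        mul_assoc]
      simp only [Complex.coe_smul, smul_sub]
      abel
    have h2 : star a * p.form x x * a ≤ s • (star a * a) := by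
      refine (CStarAlgebra.star_left_conjugate_le_norm_smul (a := a) (b := p.form x x)
        (hb := .of_nonneg (p.nonneg x))).trans ?_
      exact smul_le_smul_of_nonneg_right hs.le (star_mul_self_nonneg a)
    have h3 : s • (star a * a) ≤ s • (s • p.form y y) := by
      rw [h1] at h0
      have : 0 ≤ s • (star a * a) - s • (star a * a) - s • (star a * a) + s • (s • p.form y y) :=
        h0.trans (by gcongr)
      rw [sub_self, zero_sub, neg_add_eq_sub] at this
      exact sub_nonneg.mp this
    have h4 : star a * a ≤ s • p.form y y := by
      rwa [smul_le_smul_iff_of_pos_left hs0] at h3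
    calc ‖a‖ ^ 2 = ‖star a * a‖ := by rw [CStarRing.norm_star_mul_self, pow_two]
      _ ≤ ‖s • p.form y y‖ :=
        CStarAlgebra.norm_le_norm_of_nonneg_of_le (star_mul_self_nonneg a) h4
      _ = s * ‖p.form y y‖ := by rw [norm_smul, Real.norm_of_nonneg hs0.le]
  refine le_of_forall_pos_le_add fun ε hε => ?_
  have hpos : 0 < ‖p.form y y‖ + 1 := by positivity
  refine (key (‖p.form x x‖ + ε / (‖p.form y y‖ + 1)) (by
    have : 0 < ε / (‖p.form y y‖ + 1) := by positivity
    linarith)).trans ?_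
  rw [add_mul]
  gcongr
  rw [div_mul_eq_mul_div, div_le_iff₀ hpos]
  gcongr
  linarith

/-- In a C⋆-algebra `‖a‖² - a⋆a` is of the form `(‖a‖ + b)⋆(‖a‖ + b)` in the unitization. -/
lemma exists_defect (a : A) : ∃ b : A,
    (‖a‖ : ℂ) • b + (‖a‖ : ℂ) • star b + star b * b = - (star a * a) := by
  let f : ℝ → ℝ := fun t => √(‖a‖ ^ 2 - t) - ‖a‖
  have hf0 : f 0 = 0 := by simp [f, Real.sqrt_sq (norm_nonneg a)]
  have hfc : Continuous f := by fun_prop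
  have hsa : IsSelfAdjoint (star a * a) := .star_mul_self a
  let b : A := cfcₙ f (star a * a)
  have hb : star b = b := (IsSelfAdjoint.cfcₙ (f := f) (a := star a * a)).star_eq
  refine ⟨b, ?_⟩
  rw [hb]
  have e1 : (‖a‖ : ℂ) • b + (‖a‖ : ℂ) • b + b * b
      = cfcₙ (fun t => ‖a‖ * f t + ‖a‖ * f t + f t * f t) (star a * a) := by
    rw [cfcₙ_add .., cfcₙ_add .., cfcₙ_const_mul .., cfcₙ_mul ..]
    simp [b, Complex.coe_smul]
  have e2 : - (star a * a) = cfcₙ (fun t : ℝ => - t) (star a * a) := by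
    rw [cfcₙ_neg_id ..]
  rw [e1, e2]
  refine cfcₙ_congr fun t ht => ?_
  have ht2 : t ≤ ‖a‖ ^ 2 := by
    have := NonUnitalIsometricContinuousFunctionalCalculus.norm_quasispectrum_le (𝕜 := ℝ) (star a * a) ht
    rw [CStarRing.norm_star_mul_self, ← pow_two] at this
    exact (le_abs_self t).trans this
  have hsq : √(‖a‖ ^ 2 - t) * √(‖a‖ ^ 2 - t) = ‖a‖ ^ 2 - t :=
    Real.mul_self_sqrt (by linarith)
  simp only [f]
  nlinarith [hsq]

lemma form_lact_self_le (p : PreCorr A C P) (a : A) (x : P) :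
    p.form (p.lact a x) (p.lact a x) ≤ ‖a‖ ^ 2 • p.form x x := by
  obtain ⟨b, hb⟩ := exists_defect a
  have h0 : 0 ≤ p.form ((‖a‖ : ℂ) • x + p.lact b x) ((‖a‖ : ℂ) • x + p.lact b x) := p.nonneg _
  have h1 : p.form ((‖a‖ : ℂ) • x + p.lact b x) ((‖a‖ : ℂ) • x + p.lact b x)
      = ‖a‖ ^ 2 • p.form x x
        + p.form x (p.lact ((‖a‖ : ℂ) • b + (‖a‖ : ℂ) • star b + star b * b) x) := by
    simp only [map_add, LinearMap.add_apply, map_smul, LinearMap.map_smulₛₗ, LinearMap.smul_apply,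
      p.form_lact, Complex.conj_ofReal, map_mul, Module.End.mul_apply]
    rw [smul_add, smul_smul, pow_two, ← Complex.coe_smul (‖a‖ * ‖a‖), Complex.ofReal_mul]
    abel
  rw [h1, hb, map_neg, LinearMap.neg_apply, map_neg, map_mul, Module.End.mul_apply,
    ← p.form_lact, ← sub_eq_add_neg, sub_nonneg] at h0
  exact h0

lemma norm_form_lact_self_le (p : PreCorr A C P) (a : A) (x : P) :
    ‖p.form (p.lact a x) (p.lact a x)‖ ≤ ‖a‖ ^ 2 * ‖p.form x x‖ := by
  refine (CStarAlgebra.norm_le_norm_of_nonneg_of_le (p.nonneg _)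
    (p.form_lact_self_le a x)).trans ?_
  rw [norm_smul, Real.norm_of_nonneg (by positivity)]

/-- If `X` is the negative part of `G`, then `X = s⋆s` and `X G X = -(sX)⋆(sX)`; in particular `G`
is nonnegative as soon as `sX = 0`. -/
lemma exists_negPart_factor {M : Type*} [NonUnitalCStarAlgebra M] [PartialOrder M]
    [StarOrderedRing M] (G : M) (hG : IsSelfAdjoint G) :
    ∃ s X : M, star X = X ∧ X * G * X = - (star (s * X) * (s * X)) ∧
      (s * X = 0 → ∃ c, G = star c * c) := by
  obtain ⟨X, hX⟩ : ∃ X : M, X = G⁻ := ⟨_, rfl⟩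
  have hX0 : 0 ≤ X := hX ▸ CFC.negPart_nonneg G
  have hXs : star X = X := (IsSelfAdjoint.of_nonneg hX0).star_eq
  obtain ⟨s, hs⟩ := CStarAlgebra.nonneg_iff_eq_star_mul_self.mp hX0
  refine ⟨s, X, hXs, ?_, fun hsX => ?_⟩
  · have : G = G⁺ - X := by rw [hX]; exact (CFC.posPart_sub_negPart G).symm
    calc X * G * X = X * (G⁺ - X) * X := by rw [← this]
      _ = - (X * X * X) := by
        rw [mul_sub]
        conv_lhs => rw [hX, CFC.negPart_mul_posPart, ← hX, zero_sub, neg_mul]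
      _ = - (star (s * X) * (s * X)) := by
        rw [star_mul, hXs, mul_assoc X (star s), ← mul_assoc (star s), ← hs, mul_assoc]
  · have hXX : star X * X = 0 := by
      rw [hXs]
      nth_rewrite 1 [hs]
      rw [mul_assoc, hsX, mul_zero]
    have : X = 0 := CStarRing.star_mul_self_eq_zero_iff _ |>.mp hXX
    rw [hX, CFC.negPart_eq_zero_iff G] at this
    exact CStarAlgebra.nonneg_iff_eq_star_mul_self.mp this

/-- A Gram matrix with values in a C⋆-algebra is of the form `c⋆c`. -/
lemma exists_gram (p : PreCorr A C P) {ι : Type*} [Fintype ι] (x : ι → P) :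
    ∃ c : ι → ι → C, ∀ i j, p.form (x i) (x j) = ∑ l, star (c l i) * c l j := by
  let G : CStarMatrix ι ι C := CStarMatrix.ofMatrix fun i j => p.form (x i) (x j)
  have hGe : ∀ i j, G i j = p.form (x i) (x j) := fun _ _ => rfl
  have hGsa : IsSelfAdjoint G := by
    ext i j
    rw [CStarMatrix.star_apply, hGe, hGe, p.symm]
  obtain ⟨s, X, hXs, hXGX, hfac⟩ := exists_negPart_factor G hGsa
  have hsX : s * X = 0 := by
    ext l j
    have h1 : 0 ≤ (X * G * X) j j := by
      have : (X * G * X) j j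
          = p.form (∑ k, p.ract (X k j) (x k)) (∑ k, p.ract (X k j) (x k)) := by
        simp only [CStarMatrix.mul_apply, map_sum, LinearMap.sum_apply, p.form_ract,
          p.form_ract_left, Finset.sum_mul]
        refine Finset.sum_congr rfl fun k _ => Finset.sum_congr rfl fun m _ => ?_
        have : X j m = star (X m j) := by
          conv_lhs => rw [← hXs]
          rfl
        rw [this, hGe]
      rw [this]
      exact p.nonneg _
    have h2 : (X * G * X) j j = - ∑ l, star ((s * X) l j) * (s * X) l j := by
      rw [hXGX, CStarMatrix.neg_apply, CStarMatrix.mul_apply]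
      rfl
    have h3 : ∑ l, star ((s * X) l j) * (s * X) l j = 0 := by
      refine le_antisymm ?_ (Finset.sum_nonneg fun _ _ => star_mul_self_nonneg _)
      rw [h2] at h1
      exact neg_nonneg.mp h1
    have h4 := (Finset.sum_eq_zero_iff_of_nonneg
      (fun i _ => star_mul_self_nonneg ((s * X) i j))).mp h3 l (Finset.mem_univ _)
    exact CStarRing.star_mul_self_eq_zero_iff _ |>.mp h4
  obtain ⟨c, hc⟩ := hfac hsX
  refine ⟨fun l i => c l i, fun i j => ?_⟩
  rw [← hGe, hc, CStarMatrix.mul_apply]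
  rfl

end PreCorr

/-! ### The algebraic interior tensor product -/

namespace PreCorr

variable {A B C : Type*} [NonUnitalCStarAlgebra A] [NonUnitalCStarAlgebra B]
    [PartialOrder B] [StarOrderedRing B] [NonUnitalCStarAlgebra C]
    [PartialOrder C] [StarOrderedRing C]
    {P Q : Type*} [AddCommGroup P] [Module ℂ P] [AddCommGroup Q] [Module ℂ Q]

/-- The form `⟨x ⊗ y, x' ⊗ y'⟩ = ⟨y, ⟨x, x'⟩ · y'⟩` on the algebraic tensor product. -/
def tensorForm (p : PreCorr A B P) (q : PreCorr B C Q) :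
    P ⊗[ℂ] Q →ₗ⋆[ℂ] P ⊗[ℂ] Q →ₗ[ℂ] C :=
  TensorProduct.lift <| LinearMap.mk₂'ₛₗ (starRingEnd ℂ) (starRingEnd ℂ)
    (fun x y => TensorProduct.lift <| LinearMap.mk₂ ℂ
      (fun x' y' => q.form y (q.lact (p.form x x') y'))
      (by intros; simp) (by intros; simp) (by intros; simp) (by intros; simp))
    (by intros; ext; simp) (by intros; ext; simp) (by intros; ext; simp) (by intros; ext; simp)

@[simp] lemma tensorForm_tmul (p : PreCorr A B P) (q : PreCorr B C Q) (x x' : P) (y y' : Q) :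
    p.tensorForm q (x ⊗ₜ y) (x' ⊗ₜ y') = q.form y (q.lact (p.form x x') y') := rfl

lemma exists_fin_sum (z : P ⊗[ℂ] Q) :
    ∃ (n : ℕ) (x : Fin n → P) (y : Fin n → Q), z = ∑ i, x i ⊗ₜ[ℂ] y i := by
  induction z with
  | zero => exact ⟨0, Fin.elim0, Fin.elim0, by simp⟩
  | tmul x y => exact ⟨1, fun _ => x, fun _ => y, by simp⟩
  | add a b ha hb =>
    obtain ⟨n, x, y, rfl⟩ := ha
    obtain ⟨m, x', y', rfl⟩ := hb
    exact ⟨n + m, Fin.append x x', Fin.append y y', by simp [Fin.sum_univ_add]⟩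

lemma tensorForm_sum (p : PreCorr A B P) (q : PreCorr B C Q) {n : ℕ} (x : Fin n → P)
    (y : Fin n → Q) :
    p.tensorForm q (∑ i, x i ⊗ₜ[ℂ] y i) (∑ i, x i ⊗ₜ[ℂ] y i)
      = ∑ i, ∑ j, q.form (y i) (q.lact (p.form (x i) (x j)) (y j)) := by
  simp only [map_sum, LinearMap.sum_apply, tensorForm_tmul]
  exact Finset.sum_comm

/-- Diagonalisation of the tensor form through a factorisation of the Gram matrix. -/
lemma tensorForm_eq_of_gram (p : PreCorr A B P) (q : PreCorr B C Q) {n : ℕ} (x : Fin n → P)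
    (y : Fin n → Q) (c : Fin n → Fin n → B)
    (hc : ∀ i j, p.form (x i) (x j) = ∑ l, star (c l i) * c l j) :
    p.tensorForm q (∑ i, x i ⊗ₜ[ℂ] y i) (∑ i, x i ⊗ₜ[ℂ] y i)
      = ∑ l, q.form (∑ i, q.lact (c l i) (y i)) (∑ i, q.lact (c l i) (y i)) := by
  rw [tensorForm_sum]
  simp only [hc, map_sum, LinearMap.sum_apply, map_mul, Module.End.mul_apply, q.form_lact]
  rw [Finset.sum_comm_cycle]
  refine Finset.sum_congr rfl fun l _ => ?_
  exact Finset.sum_comm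

/-- The algebraic interior tensor product `P ⊗_B Q`. -/
def tensor (p : PreCorr A B P) (q : PreCorr B C Q) : PreCorr A C (P ⊗[ℂ] Q) where
  form := p.tensorForm q
  nonneg z := by
    obtain ⟨n, x, y, rfl⟩ := exists_fin_sum z
    obtain ⟨c, hc⟩ := p.exists_gram x
    rw [tensorForm_eq_of_gram p q x y c hc]
    exact Finset.sum_nonneg fun _ _ => q.nonneg _
  symm z z' := by
    induction z with
    | zero => simp
    | add a b ha hb => simp [ha, hb]
    | tmul x y =>
      induction z' with
      | zero => simp
      | add a b ha hb => simp [ha, hb]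
      | tmul x' y' => rw [tensorForm_tmul, tensorForm_tmul, q.symm, q.form_lact, p.symm]
  ract c := LinearMap.lTensor P (q.ract c)
  form_ract z z' c := by
    induction z with
    | zero => simp
    | add a b ha hb => simp [ha, hb, add_mul]
    | tmul x y =>
      induction z' with
      | zero => simp
      | add a b ha hb => simp [ha, hb, add_mul]
      | tmul x' y' =>
        rw [LinearMap.lTensor_tmul, tensorForm_tmul, tensorForm_tmul]
        have : ∀ w w' b, q.form w (q.lact b (q.ract c w')) = q.form w (q.lact b w') * c := by
          intro w w' b
          have := q.form_lact (star b) w (q.ract c w')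
          rw [star_star] at this
          rw [← this, q.form_ract, q.form_lact, star_star]
        exact this _ _ _
  lact :=
    { toFun := fun a => LinearMap.rTensor Q (p.lact a)
      map_smul' := fun r a => by
        rw [map_smul, LinearMap.rTensor_smul]; rfl
      map_zero' := by rw [map_zero, LinearMap.rTensor_zero]
      map_add' := fun a b => by rw [map_add, LinearMap.rTensor_add]
      map_mul' := fun a b => by
        rw [map_mul, Module.End.mul_eq_comp, LinearMap.rTensor_comp]; rfl }
  form_lact a z z' := by
    change p.tensorForm q (LinearMap.rTensor Q (p.lact a) z) z'
      = p.tensorForm q z (LinearMap.rTensor Q (p.lact (star a)) z')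
    induction z with
    | zero => simp
    | add a b ha hb => simp [ha, hb]
    | tmul x y =>
      induction z' with
      | zero => simp
      | add a b ha hb => rw [map_add, map_add, map_add, ha, hb]
      | tmul x' y' => simp [p.form_lact]

@[simp] lemma tensor_form_tmul (p : PreCorr A B P) (q : PreCorr B C Q) (x x' : P) (y y' : Q) :
    (p.tensor q).form (x ⊗ₜ y) (x' ⊗ₜ y') = q.form y (q.lact (p.form x x') y') := rfl

@[simp] lemma tensor_ract_tmul (p : PreCorr A B P) (q : PreCorr B C Q) (c : C) (x : P) (y : Q) :
    (p.tensor q).ract c (x ⊗ₜ y) = x ⊗ₜ q.ract c y := rfl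

@[simp] lemma tensor_lact_tmul (p : PreCorr A B P) (q : PreCorr B C Q) (a : A) (x : P) (y : Q) :
    (p.tensor q).lact a (x ⊗ₜ y) = p.lact a x ⊗ₜ y := rfl

/-! ### Completion -/

/-- The seminorm `‖x‖ = ‖⟨x, x⟩‖^{1/2}`. -/
@[reducible]
def formNorm (p : PreCorr A C P) : Norm P where
  norm x := √‖p.form x x‖

lemma seminormedCore (p : PreCorr A C P) :
    letI := p.formNorm
    SeminormedSpace.Core ℂ P :=
  letI := p.formNorm
  { norm_nonneg := fun _ => Real.sqrt_nonneg _
    norm_smul := fun c x => by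
      have h2 : ‖p.form (c • x) (c • x)‖ = ‖c‖ ^ 2 * ‖p.form x x‖ := by
        rw [map_smul, LinearMap.map_smulₛₗ, LinearMap.smul_apply, norm_smul, norm_smul,
          RCLike.norm_conj, pow_two, mul_assoc]
      change √‖p.form (c • x) (c • x)‖ = ‖c‖ * √‖p.form x x‖
      rw [h2, Real.sqrt_mul (by positivity), Real.sqrt_sq (norm_nonneg _)]
    norm_triangle := fun x y => by
      change √‖p.form (x + y) (x + y)‖ ≤ √‖p.form x x‖ + √‖p.form y y‖
      have hle : ∀ x y, ‖p.form x y‖ ≤ √‖p.form x x‖ * √‖p.form y y‖ := fun x y => by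
        rw [← Real.sqrt_mul (norm_nonneg _)]
        exact Real.le_sqrt_of_sq_le (p.norm_form_le x y)
      refine Real.sqrt_le_iff.mpr ⟨by positivity, ?_⟩
      have : p.form (x + y) (x + y) = p.form x x + p.form x y + p.form y x + p.form y y := by
        rw [map_add, map_add, LinearMap.add_apply, LinearMap.add_apply]
        abel
      calc ‖p.form (x + y) (x + y)‖
          ≤ ‖p.form x x‖ + ‖p.form x y‖ + ‖p.form y x‖ + ‖p.form y y‖ := by
            rw [this]; exact norm_add₄_le
        _ ≤ √‖p.form x x‖ ^ 2 + √‖p.form x x‖ * √‖p.form y y‖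
            + √‖p.form y y‖ * √‖p.form x x‖ + √‖p.form y y‖ ^ 2 := by
            rw [Real.sq_sqrt (norm_nonneg _), Real.sq_sqrt (norm_nonneg _)]
            gcongr <;> exact hle _ _
        _ = (√‖p.form x x‖ + √‖p.form y y‖) ^ 2 := by ring }

/-- The underlying space, equipped with the seminorm `‖x‖ = ‖⟨x, x⟩‖^{1/2}`. -/
@[nolint unusedArguments]
def Space (_p : PreCorr A C P) : Type _ := P

instance (p : PreCorr A C P) : SeminormedAddCommGroup p.Space :=
  letI := p.formNorm
  SeminormedAddCommGroup.ofCore (E := P) p.seminormedCore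

instance (p : PreCorr A C P) : NormedSpace ℂ p.Space :=
  letI := p.formNorm
  { (inferInstance : Module ℂ P) with
    norm_smul_le := fun c x => (p.seminormedCore.norm_smul c x).le }

/-- The Hausdorff completion. -/
abbrev Compl (p : PreCorr A C P) : Type _ := UniformSpace.Completion p.Space

/-- The canonical map into the completion. -/
def toCompl (p : PreCorr A C P) : P →ₗ[ℂ] p.Compl where
  toFun x := ((show p.Space from x : p.Space) : p.Compl)
  map_add' x y := UniformSpace.Completion.coe_add (α := p.Space) x y
  map_smul' c x := by
    let x' : p.Space := x
    exact UniformSpace.Completion.coe_smul c x'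

lemma norm_toCompl (p : PreCorr A C P) (x : P) : ‖p.toCompl x‖ = √‖p.form x x‖ :=
  UniformSpace.Completion.norm_coe (E := p.Space) _

lemma norm_form_le' (p : PreCorr A C P) (x y : P) :
    ‖p.form x y‖ ≤ √‖p.form x x‖ * √‖p.form y y‖ := by
  rw [← Real.sqrt_mul (norm_nonneg _)]
  exact Real.le_sqrt_of_sq_le (p.norm_form_le x y)

lemma denseRange_toCompl (p : PreCorr A C P) : DenseRange p.toCompl :=
  UniformSpace.Completion.denseRange_coe (α := p.Space)

/-- Extension of a bounded linear map to the completion. -/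
def extend (p : PreCorr A C P) {σ : ℂ →+* ℂ} {K : Type*} [NormedAddCommGroup K] [NormedSpace ℂ K]
    [CompleteSpace K] (f : P →ₛₗ[σ] K) : p.Compl →SL[σ] K :=
  f.extendOfNorm p.toCompl

lemma extend_toCompl (p : PreCorr A C P) {σ : ℂ →+* ℂ} {K : Type*} [NormedAddCommGroup K]
    [NormedSpace ℂ K] [CompleteSpace K] (f : P →ₛₗ[σ] K) (M : ℝ)
    (h : ∀ x, ‖f x‖ ≤ M * √‖p.form x x‖) (x : P) :
    p.extend f (p.toCompl x) = f x :=
  LinearMap.extendOfNorm_eq p.denseRange_toCompl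
    ⟨M, fun x => by rw [norm_toCompl]; exact h x⟩ x

lemma norm_extend_apply_le (p : PreCorr A C P) {K : Type*} [NormedAddCommGroup K]
    [NormedSpace ℂ K] [CompleteSpace K] (f : P →ₗ[ℂ] K) (M : ℝ)
    (h : ∀ x, ‖f x‖ ≤ M * √‖p.form x x‖) (z : p.Compl) : ‖p.extend f z‖ ≤ M * ‖z‖ := by
  refine p.denseRange_toCompl.induction_on z
    (isClosed_le (by fun_prop) (by fun_prop)) fun x => ?_
  rw [p.extend_toCompl f M h, norm_toCompl]
  exact h x

/-- The left action on the completion. -/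
def lactCompl (p : PreCorr A C P) (a : A) : p.Compl →L[ℂ] p.Compl :=
  p.extend (p.toCompl ∘ₗ p.lact a)

lemma lactCompl_toCompl (p : PreCorr A C P) (a : A) (x : P) :
    p.lactCompl a (p.toCompl x) = p.toCompl (p.lact a x) := by
  refine p.extend_toCompl (p.toCompl ∘ₗ p.lact a) ‖a‖ (fun x => ?_) x
  rw [LinearMap.comp_apply, norm_toCompl]
  refine Real.sqrt_le_iff.mpr ⟨by positivity, ?_⟩
  rw [mul_pow, Real.sq_sqrt (norm_nonneg _)]
  exact p.norm_form_lact_self_le a x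

/-- Two continuous maps on the completion agree if they agree on the dense image. -/
lemma compl_ext (p : PreCorr A C P) {X : Type*} [TopologicalSpace X] [T2Space X]
    {f g : p.Compl → X} (hf : Continuous f) (hg : Continuous g)
    (h : ∀ x, f (p.toCompl x) = g (p.toCompl x)) (z : p.Compl) : f z = g z :=
  congrFun (p.denseRange_toCompl.equalizer hf hg (funext h)) z

lemma lactCompl_add (p : PreCorr A C P) (a b : A) (z : p.Compl) :
    p.lactCompl (a + b) z = p.lactCompl a z + p.lactCompl b z :=
  p.compl_ext (f := fun z => p.lactCompl (a + b) z) (g := fun z => p.lactCompl a z + p.lactCompl b z)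
    (by fun_prop) (by fun_prop) (fun x => by simp [lactCompl_toCompl]) z

lemma lactCompl_smul (p : PreCorr A C P) (r : ℂ) (a : A) (z : p.Compl) :
    p.lactCompl (r • a) z = r • p.lactCompl a z := by
  refine p.compl_ext (f := fun z => p.lactCompl (r • a) z) (g := fun z => (r • p.lactCompl a) z)
    (p.lactCompl (r • a)).continuous (r • p.lactCompl a).continuous (fun x => ?_) z
  simp only [_root_.smul_apply, lactCompl_toCompl]
  rw [← map_smul, map_smul p.lact]
  rfl

lemma lactCompl_mul (p : PreCorr A C P) (a b : A) (z : p.Compl) :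
    p.lactCompl (a * b) z = p.lactCompl a (p.lactCompl b z) :=
  p.compl_ext (f := fun z => p.lactCompl (a * b) z) (g := fun z => p.lactCompl a (p.lactCompl b z))
    (by fun_prop) (by fun_prop) (fun x => by simp [lactCompl_toCompl]) z

/-- The right action on the completion. -/
def ractCompl (p : PreCorr A C P) (c : C) : p.Compl →L[ℂ] p.Compl :=
  p.extend (p.toCompl ∘ₗ p.ract c)

lemma ractCompl_toCompl (p : PreCorr A C P) (c : C) (x : P) :
    p.ractCompl c (p.toCompl x) = p.toCompl (p.ract c x) := by
  refine p.extend_toCompl (p.toCompl ∘ₗ p.ract c) ‖c‖ (fun x => ?_) x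
  rw [LinearMap.comp_apply, norm_toCompl]
  refine Real.sqrt_le_iff.mpr ⟨by positivity, ?_⟩
  rw [mul_pow, Real.sq_sqrt (norm_nonneg _), p.form_ract, p.form_ract_left]
  calc ‖star c * p.form x x * c‖ ≤ ‖star c‖ * ‖p.form x x‖ * ‖c‖ := norm_mul₃_le
    _ = ‖c‖ ^ 2 * ‖p.form x x‖ := by rw [norm_star]; ring

/-- The form with its second variable extended to the completion. -/
def formExt (p : PreCorr A C P) : P →ₗ⋆[ℂ] (p.Compl →L[ℂ] C) where
  toFun x := p.extend (p.form x)
  map_add' x y := by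
    ext z
    refine p.compl_ext (by fun_prop) (by fun_prop) (fun w => ?_) z
    simp only [_root_.add_apply]
    rw [p.extend_toCompl _ _ (p.norm_form_le' _), p.extend_toCompl _ _ (p.norm_form_le' _),
      p.extend_toCompl _ _ (p.norm_form_le' _), map_add, LinearMap.add_apply]
  map_smul' c x := by
    ext z
    refine p.compl_ext (by fun_prop) (by fun_prop) (fun w => ?_) z
    simp only [_root_.smul_apply]
    rw [p.extend_toCompl _ _ (p.norm_form_le' _), p.extend_toCompl _ _ (p.norm_form_le' _),
      LinearMap.map_smulₛₗ, LinearMap.smul_apply]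

lemma norm_formExt_le (p : PreCorr A C P) (x : P) : ‖p.formExt x‖ ≤ 1 * √‖p.form x x‖ := by
  rw [one_mul]
  exact ContinuousLinearMap.opNorm_le_bound _ (Real.sqrt_nonneg _) fun z =>
    p.norm_extend_apply_le _ _ (p.norm_form_le' x) z

/-- The form on the completion. -/
def formCompl (p : PreCorr A C P) : p.Compl →L⋆[ℂ] (p.Compl →L[ℂ] C) :=
  p.extend p.formExt

lemma formCompl_toCompl (p : PreCorr A C P) (x y : P) :
    p.formCompl (p.toCompl x) (p.toCompl y) = p.form x y := by
  rw [formCompl, p.extend_toCompl _ 1 p.norm_formExt_le]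
  exact p.extend_toCompl _ _ (p.norm_form_le' x) y

lemma compl_ext₂ (p : PreCorr A C P) {X : Type*} [TopologicalSpace X] [T2Space X]
    {f g : p.Compl → p.Compl → X} (hf : Continuous (Function.uncurry f))
    (hg : Continuous (Function.uncurry g))
    (h : ∀ x y, f (p.toCompl x) (p.toCompl y) = g (p.toCompl x) (p.toCompl y)) (z w : p.Compl) :
    f z w = g z w :=
  p.compl_ext (f := fun z => f z w) (g := fun z => g z w) (hf.uncurry_right w)
    (hg.uncurry_right w)
    (fun x => p.compl_ext (hf.uncurry_left _) (hg.uncurry_left _) (h x) w) z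

lemma continuous_formCompl (p : PreCorr A C P) :
    Continuous (Function.uncurry fun z w => p.formCompl z w) := by
  unfold Function.uncurry
  fun_prop

lemma formCompl_symm (p : PreCorr A C P) (z w : p.Compl) :
    star (p.formCompl z w) = p.formCompl w z :=
  p.compl_ext₂ (f := fun z w => star (p.formCompl z w)) (g := fun z w => p.formCompl w z)
    p.continuous_formCompl.star (p.continuous_formCompl.comp continuous_swap)
    (fun x y => by simp [formCompl_toCompl, p.symm]) z w

lemma formCompl_ract (p : PreCorr A C P) (z w : p.Compl) (c : C) :
    p.formCompl z (p.ractCompl c w) = p.formCompl z w * c :=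
  p.compl_ext₂ (f := fun z w => p.formCompl z (p.ractCompl c w))
    (g := fun z w => p.formCompl z w * c)
    (by unfold Function.uncurry; fun_prop)
    (p.continuous_formCompl.mul continuous_const)
    (fun x y => by simp [formCompl_toCompl, ractCompl_toCompl, p.form_ract]) z w

lemma formCompl_lact (p : PreCorr A C P) (a : A) (z w : p.Compl) :
    p.formCompl (p.lactCompl a z) w = p.formCompl z (p.lactCompl (star a) w) :=
  p.compl_ext₂ (f := fun z w => p.formCompl (p.lactCompl a z) w)
    (g := fun z w => p.formCompl z (p.lactCompl (star a) w))
    (by unfold Function.uncurry; fun_prop)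
    (by unfold Function.uncurry; fun_prop)
    (fun x y => by simp [formCompl_toCompl, lactCompl_toCompl, p.form_lact]) z w

lemma formCompl_self_nonneg (p : PreCorr A C P) (z : p.Compl) : 0 ≤ p.formCompl z z := by
  refine p.denseRange_toCompl.induction_on z ?_ fun x => ?_
  · have : Continuous fun z : p.Compl => p.formCompl z z :=
      p.continuous_formCompl.comp (continuous_id.prodMk continuous_id)
    exact (CStarAlgebra.isClosed_nonneg (A := C)).preimage this
  · rw [formCompl_toCompl]
    exact p.nonneg x

lemma norm_formCompl_self (p : PreCorr A C P) (z : p.Compl) : ‖z‖ = √‖p.formCompl z z‖ := by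
  refine p.compl_ext (f := fun z => ‖z‖) (g := fun z => √‖p.formCompl z z‖) continuous_norm ?_
    (fun x => ?_) z
  · have : Continuous fun z : p.Compl => p.formCompl z z :=
      p.continuous_formCompl.comp (continuous_id.prodMk continuous_id)
    fun_prop
  · rw [formCompl_toCompl, norm_toCompl]

end PreCorr

/-! ### Hilbert space representations and C⋆-correspondences -/

/-- A representation of the C⋆-algebra `B` on a Hilbert space: the Hilbert space together with the
⋆-homomorphism into its bounded operators. -/
structure HilbRep (B : Type w) [NonUnitalCStarAlgebra B] where
  carrier : Type u
  [normedAddCommGroup : NormedAddCommGroup carrier]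
  [innerProductSpace : InnerProductSpace ℂ carrier]
  [completeSpace : CompleteSpace carrier]
  rep : B →⋆ₙₐ[ℂ] (carrier →L[ℂ] carrier)

/-- A C⋆-correspondence over `B`: a right Hilbert C⋆-module over `B` (in Mathlib's convention, a
`CStarModule` over `Bᵐᵒᵖ`) with a left action of `B`, i.e. a ⋆-homomorphism of `B` into the
adjointable maps of the module. -/
structure CStarCorr (B : Type w) [NonUnitalCStarAlgebra B] [PartialOrder B]
    [StarOrderedRing B] where
  carrier : Type u
  [normedAddCommGroup : NormedAddCommGroup carrier]
  [normedSpace : NormedSpace ℂ carrier]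
  [completeSpace : CompleteSpace carrier]
  [rightAction : SMul Bᵐᵒᵖ carrier]
  [cstarModule : CStarModule Bᵐᵒᵖ carrier]
  lact : B →ₙₐ[ℂ] Module.End ℂ carrier
  inner_lact : ∀ (a : B) (x y : carrier),
    inner Bᵐᵒᵖ (lact a x) y = inner Bᵐᵒᵖ x (lact (star a) y)

attribute [instance] HilbRep.normedAddCommGroup HilbRep.innerProductSpace HilbRep.completeSpace
attribute [instance] CStarCorr.normedAddCommGroup CStarCorr.normedSpace CStarCorr.completeSpace
  CStarCorr.rightAction CStarCorr.cstarModule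

instance {B : Type w} [NonUnitalCStarAlgebra B] : CoeSort (HilbRep.{w, u} B) (Type u) :=
  ⟨HilbRep.carrier⟩

instance {B : Type w} [NonUnitalCStarAlgebra B] [PartialOrder B] [StarOrderedRing B] :
    CoeSort (CStarCorr.{w, u} B) (Type u) := ⟨CStarCorr.carrier⟩

namespace PreCorr

variable {B : Type w} [NonUnitalCStarAlgebra B] {P : Type u} [AddCommGroup P] [Module ℂ P]

instance (p : PreCorr B ℂ P) : InnerProductSpace ℂ p.Space where
  inner x y := p.form x y
  norm_sq_eq_re_inner x := by
    have h : 0 ≤ p.form x x := p.nonneg x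
    change √‖p.form x x‖ ^ 2 = (p.form x x).re
    rw [Real.sq_sqrt (norm_nonneg _)]
    exact (Complex.re_eq_norm.mpr h).symm
  conj_inner_symm x y := p.symm y x
  add_left x y z := by
    have h : ∀ x y z : P, p.form (x + y) z = p.form x z + p.form y z := by intros; simp
    exact h x y z
  smul_left x y r := by
    have h : ∀ x y : P, p.form (r • x) y = starRingEnd ℂ r * p.form x y := by intros; simp
    exact h x y

lemma inner_toCompl (p : PreCorr B ℂ P) (x y : P) :
    inner ℂ (p.toCompl x) (p.toCompl y) = p.form x y :=
  UniformSpace.Completion.inner_coe (E := p.Space) x y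

/-- The Hilbert space representation obtained by completing a `ℂ`-valued pre-correspondence. -/
def toHilbRep (p : PreCorr B ℂ P) : HilbRep.{w, u} B where
  carrier := p.Compl
  rep :=
    { toFun := p.lactCompl
      map_smul' := fun r a => by ext z; exact p.lactCompl_smul r a z
      map_zero' := by
        ext z
        have := p.lactCompl_smul 0 0 z
        rwa [zero_smul, zero_smul] at this
      map_add' := fun a b => by ext z; exact p.lactCompl_add a b z
      map_mul' := fun a b => by ext z; exact p.lactCompl_mul a b z
      map_star' := fun a => by
        rw [ContinuousLinearMap.star_eq_adjoint, ContinuousLinearMap.eq_adjoint_iff]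
        refine p.compl_ext₂ (f := fun z w => inner ℂ (p.lactCompl (star a) z) w)
          (g := fun z w => inner ℂ z (p.lactCompl a w)) ?_ ?_ fun x y => ?_
        · unfold Function.uncurry; fun_prop
        · unfold Function.uncurry; fun_prop
        · rw [lactCompl_toCompl, lactCompl_toCompl, inner_toCompl, inner_toCompl, p.form_lact,
            star_star] }

variable [PartialOrder B] [StarOrderedRing B]

/-- The C⋆-correspondence obtained by completing a `B`-valued pre-correspondence. -/
def toCorr (p : PreCorr B B P) : CStarCorr.{w, u} B where
  carrier := p.Compl
  rightAction := ⟨fun b z => p.ractCompl b.unop z⟩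
  cstarModule :=
    letI : SMul Bᵐᵒᵖ p.Compl := ⟨fun b z => p.ractCompl b.unop z⟩
    { inner := fun z w => MulOpposite.op (p.formCompl z w)
      inner_add_right := by intros; simp
      inner_self_nonneg := fun {z} => p.formCompl_self_nonneg z
      inner_self := fun {z} => by
        rw [MulOpposite.op_eq_zero_iff, ← norm_eq_zero, ← norm_eq_zero (a := z),
          p.norm_formCompl_self z, Real.sqrt_eq_zero (norm_nonneg _)]
      inner_op_smul_right := fun {b z w} => by
        change MulOpposite.op (p.formCompl z (p.ractCompl b.unop w)) = _
        rw [formCompl_ract, MulOpposite.op_mul, MulOpposite.op_unop]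
      inner_smul_right_complex := by intros; simp
      star_inner := fun z w => by
        rw [← MulOpposite.op_star, formCompl_symm]
      norm_eq_sqrt_norm_inner_self := fun z => p.norm_formCompl_self z }
  lact :=
    { toFun := fun a => (p.lactCompl a : p.Compl →ₗ[ℂ] p.Compl)
      map_smul' := fun r a => by ext z; exact p.lactCompl_smul r a z
      map_zero' := by
        ext z
        have := p.lactCompl_smul 0 0 z
        rwa [zero_smul, zero_smul] at this
      map_add' := fun a b => by ext z; exact p.lactCompl_add a b z
      map_mul' := fun a b => by ext z; exact p.lactCompl_mul a b z }
  inner_lact a z w := congrArg MulOpposite.op (p.formCompl_lact a z w)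

end PreCorr

namespace HilbRep

variable {B : Type w} [NonUnitalCStarAlgebra B]

/-- A Hilbert space representation as a `ℂ`-valued pre-correspondence. -/
def toPre (H : HilbRep.{w, u} B) : PreCorr B ℂ H where
  form := innerₛₗ ℂ
  nonneg x := by
    rw [innerₛₗ_apply_apply, inner_self_eq_norm_sq_to_K]
    norm_cast
    exact Complex.zero_le_real.mpr (sq_nonneg ‖x‖)
  symm x y := inner_conj_symm y x
  ract c := c • LinearMap.id
  form_ract x y c := by simp [mul_comm]
  lact :=
    { toFun := fun a => (H.rep a : H →ₗ[ℂ] H)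
      map_smul' := fun r a => by rw [map_smul]; rfl
      map_zero' := by rw [map_zero]; rfl
      map_add' := fun a b => by rw [map_add]; rfl
      map_mul' := fun a b => by rw [map_mul]; rfl }
  form_lact a x y := by
    change inner ℂ (H.rep a x) y = inner ℂ x (H.rep (star a) y)
    rw [map_star, ContinuousLinearMap.star_eq_adjoint, ContinuousLinearMap.adjoint_inner_right]

lemma toPre_form (H : HilbRep.{w, u} B) (x y : H) : H.toPre.form x y = inner ℂ x y := rfl

lemma toPre_lact (H : HilbRep.{w, u} B) (a : B) (x : H) : H.toPre.lact a x = H.rep a x := rfl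

/-- Bounded operators between the spaces of two representations of `B` that intertwine the
representations. -/
structure Hom (H K : HilbRep.{w, u} B) where
  toCLM : H →L[ℂ] K
  comm : ∀ (a : B) (x : H), toCLM (H.rep a x) = K.rep a (toCLM x)

namespace Hom

variable {H K L : HilbRep.{w, u} B}

instance : CoeFun (Hom H K) (fun _ => H → K) := ⟨fun X => X.toCLM⟩

@[ext] lemma ext {X Y : Hom H K} (h : ∀ x, X x = Y x) : X = Y := by
  cases X; cases Y
  congr
  exact ContinuousLinearMap.ext h

/-- The identity operator. -/
def id (H : HilbRep.{w, u} B) : Hom H H := ⟨.id ℂ H, fun _ _ => rfl⟩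

/-- Composition of operators. -/
def comp (Y : Hom K L) (X : Hom H K) : Hom H L where
  toCLM := Y.toCLM ∘L X.toCLM
  comm a x := by simp [X.comm, Y.comm]

/-- The Hilbert space adjoint. -/
def adjoint (X : Hom H K) : Hom K H where
  toCLM := ContinuousLinearMap.adjoint X.toCLM
  comm a y := by
    refine ext_inner_right ℂ fun x => ?_
    have h1 : ∀ (L : HilbRep.{w, u} B) (u v : L), inner ℂ (L.rep a u) v
        = inner ℂ u (L.rep (star a) v) := fun L u v => L.toPre.form_lact a u v
    rw [ContinuousLinearMap.adjoint_inner_left, h1, ← X.comm, h1,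
      ContinuousLinearMap.adjoint_inner_left]

/-- The identity operator between equal representations. -/
def ofEq (h : H = K) : Hom H K := h ▸ id H

end Hom

/-- Operators of norm at most one. -/
def Hom.Contraction {H K : HilbRep.{w, u} B} (X : HilbRep.Hom H K) : Prop :=
  ∀ x, ‖X x‖ ≤ ‖x‖

lemma Hom.Contraction.comp {H K L : HilbRep.{w, u} B} {Y : HilbRep.Hom K L}
    {X : HilbRep.Hom H K} (hY : Y.Contraction) (hX : X.Contraction) : (Y.comp X).Contraction :=
  fun x => (hY _).trans (hX x)

lemma Hom.Contraction.adjoint {H K : HilbRep.{w, u} B} {X : HilbRep.Hom H K}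
    (hX : X.Contraction) : X.adjoint.Contraction := fun x => by
  have h1 : ‖X.toCLM‖ ≤ 1 :=
    ContinuousLinearMap.opNorm_le_bound _ zero_le_one fun y => by rw [one_mul]; exact hX y
  calc ‖ContinuousLinearMap.adjoint X.toCLM x‖ ≤ ‖ContinuousLinearMap.adjoint X.toCLM‖ * ‖x‖ :=
        ContinuousLinearMap.le_opNorm _ _
    _ ≤ 1 * ‖x‖ := by rw [LinearIsometryEquiv.norm_map]; gcongr
    _ = ‖x‖ := one_mul _

lemma Hom.contraction_ofEq {H K : HilbRep.{w, u} B} (h : H = K) :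
    (HilbRep.Hom.ofEq h).Contraction := by
  subst h
  exact fun x => le_rfl

/-- The restriction of a representation to a closed invariant subspace. -/
def sub (H : HilbRep.{w, u} B) (S : Submodule ℂ H) (hc : IsClosed (S : Set H))
    (hS : ∀ a, ∀ x ∈ S, H.rep a x ∈ S) : HilbRep.{w, u} B where
  carrier := S
  completeSpace := hc.completeSpace_coe
  rep :=
    { toFun := fun a => (H.rep a ∘L S.subtypeL).codRestrict S fun x => hS a x x.2
      map_smul' := fun r a => by
        ext x
        exact congrArg (fun f : H →L[ℂ] H => f x) (map_smul H.rep r a)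
      map_zero' := by
        ext x
        exact congrArg (fun f : H →L[ℂ] H => f x) (map_zero H.rep)
      map_add' := fun a b => by
        ext x
        exact congrArg (fun f : H →L[ℂ] H => f x) (map_add H.rep a b)
      map_mul' := fun a b => by
        ext x
        exact congrArg (fun f : H →L[ℂ] H => f x) (map_mul H.rep a b)
      map_star' := fun a => by
        have := hc.completeSpace_coe
        rw [ContinuousLinearMap.star_eq_adjoint, ContinuousLinearMap.eq_adjoint_iff]
        intro x y
        have h1 := H.toPre.form_lact (star a) x y
        rw [star_star] at h1
        exact h1 }

/-! ### Hilbert space direct sums of representations -/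

section DirectSum

variable {ι : Type} {G G' : ι → HilbRep.{w, u} B}

/-- The diagonal operator `⊕ₙ Xₙ` of a family of operators of norm at most `C`. -/
def diag (X : ∀ n, G n →L[ℂ] G' n) (C : ℝ) (hX : ∀ n x, ‖X n x‖ ≤ C * ‖x‖) :
    lp (fun n => G n) 2 →L[ℂ] lp (fun n => G' n) 2 :=
  have hmem : ∀ f : lp (fun n => G n) 2, Memℓp (fun n => X n (f n)) 2 := fun f => by
    refine memℓp_gen ?_
    have h0 := ((lp.memℓp f).summable (by simp)).mul_left (C ^ 2)
    refine h0.of_nonneg_of_le (fun n => by positivity) fun n => ?_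
    simp only [ENNReal.toReal_ofNat, Real.rpow_ofNat]
    rw [← mul_pow]
    exact pow_le_pow_left₀ (norm_nonneg _) (hX n _) 2
  LinearMap.mkContinuous
    { toFun := fun f => ⟨fun n => X n (f n), hmem f⟩
      map_add' := fun f g => by ext n; exact (X n).map_add _ _
      map_smul' := fun r f => by ext n; exact (X n).map_smul _ _ } |C| fun f => by
    have h2 : (0 : ℝ) < (2 : ENNReal).toReal := by simp
    refine lp.norm_le_of_tsum_le h2 (by positivity) ?_
    rw [Real.mul_rpow (by positivity) (by positivity), lp.norm_rpow_eq_tsum h2, ← tsum_mul_left]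
    refine Summable.tsum_le_tsum (fun n => ?_) ((hmem f).summable h2)
      (((lp.memℓp f).summable h2).mul_left _)
    rw [← Real.mul_rpow (by positivity) (by positivity)]
    refine Real.rpow_le_rpow (norm_nonneg _) ((hX n _).trans ?_) h2.le
    gcongr
    exact le_abs_self C

lemma diag_apply (X : ∀ n, G n →L[ℂ] G' n) (C : ℝ) (hX : ∀ n x, ‖X n x‖ ≤ C * ‖x‖)
    (f : lp (fun n => G n) 2) (n : ι) : diag X C hX f n = X n (f n) := rfl

lemma norm_sq_lp (f : lp (fun n => G n) 2) : ‖f‖ ^ 2 = ∑' n, ‖f n‖ ^ 2 := by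
  have := lp.norm_rpow_eq_tsum (p := 2) (by simp) f
  simpa using this

lemma summable_norm_sq (f : lp (fun n => G n) 2) : Summable fun n => ‖f n‖ ^ 2 := by
  have := (lp.memℓp f).summable (by simp)
  simpa using this

lemma norm_rep_le (H : HilbRep.{w, u} B) (a : B) (x : H) : ‖H.rep a x‖ ≤ ‖a‖ * ‖x‖ :=
  ((H.rep a).le_opNorm x).trans
    (by gcongr; exact NonUnitalStarAlgHom.norm_apply_le H.rep a)

/-- The Hilbert space direct sum of a family of representations of `B`. -/
def dsum (G : ι → HilbRep.{w, u} B) : HilbRep.{w, u} B where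
  carrier := lp (fun n => G n) 2
  rep :=
    { toFun := fun a => diag (fun n => (G n).rep a) ‖a‖ fun n x => (G n).norm_rep_le a x
      map_smul' := fun r a => by
        ext f n
        simp only [diag_apply, map_smul]
        rfl
      map_zero' := by
        ext f n
        simp only [diag_apply, map_zero]
        rfl
      map_add' := fun a b => by
        ext f n
        simp only [diag_apply, map_add]
        rfl
      map_mul' := fun a b => by
        ext f n
        simp only [diag_apply, map_mul]
        rfl
      map_star' := fun a => by
        rw [ContinuousLinearMap.star_eq_adjoint, ContinuousLinearMap.eq_adjoint_iff]
        intro f g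
        rw [lp.inner_eq_tsum, lp.inner_eq_tsum]
        refine tsum_congr fun n => ?_
        rw [diag_apply, diag_apply]
        have h1 := (G n).toPre.form_lact (star a) (f n) (g n)
        rw [star_star] at h1
        exact h1 }

/-- The coordinates of an element of a direct sum. -/
def coord (f : dsum G) (n : ι) : G n := (show lp (fun n => G n) 2 from f) n

variable [DecidableEq ι]

/-- The inclusion of a summand into a direct sum. -/
def incl (G : ι → HilbRep.{w, u} B) (n : ι) : G n →ₗᵢ[ℂ] lp (fun n => G n) 2 where
  toLinearMap := lp.lsingle (E := fun n => G n) 2 n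
  norm_map' x := lp.norm_single (E := fun n => G n) (by norm_num) n x

lemma rep_incl (G : ι → HilbRep.{w, u} B) (n : ι) (a : B) (x : G n) :
    (dsum G).rep a (incl G n x) = incl G n ((G n).rep a x) := by
  refine lp.ext (funext fun m => ?_)
  change (G m).rep a (lp.single (E := fun n => G n) 2 n x m)
    = lp.single (E := fun n => G n) 2 n ((G n).rep a x) m
  by_cases h : m = n
  · subst h
    rw [lp.single_apply_self, lp.single_apply_self]
  · rw [lp.single_apply_ne _ _ _ h, lp.single_apply_ne _ _ _ h, map_zero]

lemma orthogonalFamily_incl (G : ι → HilbRep.{w, u} B) (s : ι → ι) (hs : Function.Injective s) :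
    OrthogonalFamily ℂ (fun n => G (s n)) fun n => incl G (s n) := by
  intro n m hnm x y
  change inner ℂ (lp.single (E := fun n => G n) 2 (s n) x)
    (lp.single (E := fun n => G n) 2 (s m) y) = 0
  rw [lp.inner_single_left, lp.single_apply_ne _ _ _ (fun h => hnm (hs h)),
    inner_zero_right]

/-- For an injective map `s` of index sets, the isometry of `⊕ₙ G (s n)` into `⊕ₘ G m` that
moves the `n`-th coordinate to place `s n`. -/
def reindex (G : ι → HilbRep.{w, u} B) (s : ι → ι) (hs : Function.Injective s) :
    Hom (dsum fun n => G (s n)) (dsum G) where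
  toCLM := (orthogonalFamily_incl G s hs).linearIsometry.toContinuousLinearMap
  comm a f := by
    have h1 := ((orthogonalFamily_incl G s hs).hasSum_linearIsometry f).mapL ((dsum G).rep a)
    have h2 := (orthogonalFamily_incl G s hs).hasSum_linearIsometry
      ((dsum fun n => G (s n)).rep a f)
    refine h2.unique (h1.congr_fun fun n => ?_)
    exact (rep_incl G (s n) a _).symm

lemma norm_reindex (G : ι → HilbRep.{w, u} B) (s : ι → ι) (hs : Function.Injective s)
    (f : dsum fun n => G (s n)) : ‖reindex G s hs f‖ = ‖f‖ :=
  (orthogonalFamily_incl G s hs).linearIsometry.norm_map f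

end DirectSum

end HilbRep

variable {B : Type w} [NonUnitalCStarAlgebra B] [PartialOrder B] [StarOrderedRing B]

namespace CStarCorr

/-- The `B`-valued inner product of a C⋆-correspondence. -/
def ip (E : CStarCorr.{w, u} B) (x y : E) : B := (inner Bᵐᵒᵖ x y).unop

/-- The right action of `B` on a C⋆-correspondence. -/
def ract (E : CStarCorr.{w, u} B) (x : E) (b : B) : E := MulOpposite.op b • x

lemma ext_ip (E : CStarCorr.{w, u} B) {x y : E} (h : ∀ z, E.ip z x = E.ip z y) : x = y := by
  have h' : ∀ z, inner Bᵐᵒᵖ z x = inner Bᵐᵒᵖ z y := fun z => MulOpposite.unop_injective (h z)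
  rw [← sub_eq_zero, ← CStarModule.inner_self (A := Bᵐᵒᵖ), CStarModule.inner_sub_right, h',
    sub_self]

lemma ip_ract (E : CStarCorr.{w, u} B) (x y : E) (b : B) :
    E.ip x (E.ract y b) = E.ip x y * b := by
  simp [ip, ract]

/-- A C⋆-correspondence as a `B`-valued pre-correspondence. -/
def toPre (E : CStarCorr.{w, u} B) : PreCorr B B E where
  form := LinearMap.mk₂'ₛₗ (starRingEnd ℂ) (RingHom.id ℂ) E.ip
    (by intros; simp [ip]) (by intros; simp [ip]) (by intros; simp [ip]) (by intros; simp [ip])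
  nonneg x := CStarModule.inner_self_nonneg (A := Bᵐᵒᵖ) (x := x)
  symm x y := by
    change star (E.ip x y) = E.ip y x
    rw [ip, ← MulOpposite.unop_star, CStarModule.star_inner, ip]
  ract b :=
    { toFun := fun x => E.ract x b
      map_add' := fun x y => E.ext_ip fun z => by
        rw [ip_ract]; simp only [ip, CStarModule.inner_add_right, MulOpposite.unop_add, add_mul]
        rw [← ip, ← ip, ← ip, ← ip, ip_ract, ip_ract]
      map_smul' := fun r x => E.ext_ip fun z => by
        rw [ip_ract]
        simp only [ip, CStarModule.inner_smul_right_complex, MulOpposite.unop_smul,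
          RingHom.id_apply, smul_mul_assoc]
        rw [← ip, ← ip, ip_ract] }
  form_ract x y b := E.ip_ract x y b
  lact := E.lact
  form_lact a x y := congrArg MulOpposite.unop (E.inner_lact a x y)

lemma toPre_form (E : CStarCorr.{w, u} B) (x y : E) : E.toPre.form x y = E.ip x y := rfl

lemma norm_eq (E : CStarCorr.{w, u} B) (x : E) : ‖x‖ = √‖E.ip x x‖ :=
  CStarModule.norm_eq_sqrt_norm_inner_self (A := Bᵐᵒᵖ) x

/-- The interior tensor product `E ⊗_B F`. -/
def tensor (E F : CStarCorr.{w, u} B) : CStarCorr.{w, u} B := (E.toPre.tensor F.toPre).toCorr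

/-- The elementary tensor `x ⊗ y` in `E ⊗_B F`. -/
def tmul (E F : CStarCorr.{w, u} B) (x : E) (y : F) : E.tensor F :=
  (E.toPre.tensor F.toPre).toCompl (x ⊗ₜ y)

lemma ip_tmul (E F : CStarCorr.{w, u} B) (x x' : E) (y y' : F) :
    (E.tensor F).ip (E.tmul F x y) (E.tmul F x' y') = F.ip y (F.lact (E.ip x x') y') :=
  (E.toPre.tensor F.toPre).formCompl_toCompl (x ⊗ₜ y) (x' ⊗ₜ y')

lemma lact_tmul (E F : CStarCorr.{w, u} B) (a : B) (x : E) (y : F) :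
    (E.tensor F).lact a (E.tmul F x y) = E.tmul F (E.lact a x) y :=
  (E.toPre.tensor F.toPre).lactCompl_toCompl a (x ⊗ₜ y)

/-- The Hilbert space `E ⊗_σ H` with the representation `φ(·) ⊗ I_H` of `B`. -/
def tensorRep (E : CStarCorr.{w, u} B) (H : HilbRep.{w, u} B) : HilbRep.{w, u} B :=
  (E.toPre.tensor H.toPre).toHilbRep

/-- The canonical map of the algebraic tensor product into `E ⊗_σ H`. -/
def ofAlg (E : CStarCorr.{w, u} B) (H : HilbRep.{w, u} B) : E ⊗[ℂ] H →ₗ[ℂ] E.tensorRep H :=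
  (E.toPre.tensor H.toPre).toCompl

/-- The elementary tensor `x ⊗ h` in `E ⊗_σ H`. -/
def tmulRep (E : CStarCorr.{w, u} B) (H : HilbRep.{w, u} B) (x : E) (h : H) : E.tensorRep H :=
  E.ofAlg H (x ⊗ₜ h)

lemma norm_ofAlg (E : CStarCorr.{w, u} B) (H : HilbRep.{w, u} B) (z : E ⊗[ℂ] H) :
    ‖E.ofAlg H z‖ = √‖(E.toPre.tensor H.toPre).form z z‖ :=
  (E.toPre.tensor H.toPre).norm_toCompl z

lemma norm_sq_ofAlg (E : CStarCorr.{w, u} B) (H : HilbRep.{w, u} B) (z : E ⊗[ℂ] H) :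
    ((‖E.ofAlg H z‖ ^ 2 : ℝ) : ℂ) = (E.toPre.tensor H.toPre).form z z := by
  rw [norm_ofAlg, Real.sq_sqrt (norm_nonneg _)]
  exact (Complex.eq_coe_norm_of_nonneg ((E.toPre.tensor H.toPre).nonneg z)).symm

lemma inner_tmulRep (E : CStarCorr.{w, u} B) (H : HilbRep.{w, u} B) (x x' : E) (h h' : H) :
    inner ℂ (E.tmulRep H x h) (E.tmulRep H x' h') = inner ℂ h (H.rep (E.ip x x') h') :=
  (E.toPre.tensor H.toPre).inner_toCompl (x ⊗ₜ h) (x' ⊗ₜ h')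

lemma rep_ofAlg (E : CStarCorr.{w, u} B) (H : HilbRep.{w, u} B) (a : B) (z : E ⊗[ℂ] H) :
    (E.tensorRep H).rep a (E.ofAlg H z) = E.ofAlg H (LinearMap.rTensor H (E.lact a) z) :=
  (E.toPre.tensor H.toPre).lactCompl_toCompl a z

lemma rep_tmulRep (E : CStarCorr.{w, u} B) (H : HilbRep.{w, u} B) (a : B) (x : E) (h : H) :
    (E.tensorRep H).rep a (E.tmulRep H x h) = E.tmulRep H (E.lact a x) h :=
  E.rep_ofAlg H a (x ⊗ₜ h)

lemma denseRange_ofAlg (E : CStarCorr.{w, u} B) (H : HilbRep.{w, u} B) :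
    DenseRange (E.ofAlg H) := (E.toPre.tensor H.toPre).denseRange_toCompl

/-- Two continuous linear maps on `E ⊗_σ H` agree if they agree on elementary tensors. -/
lemma tensorRep_ext (E : CStarCorr.{w, u} B) (H : HilbRep.{w, u} B) {X : Type*}
    [NormedAddCommGroup X] [NormedSpace ℂ X] {f g : E.tensorRep H →L[ℂ] X}
    (h : ∀ x y, f (E.tmulRep H x y) = g (E.tmulRep H x y)) : f = g := by
  have hl : (f : E.tensorRep H →ₗ[ℂ] X) ∘ₗ E.ofAlg H = (g : E.tensorRep H →ₗ[ℂ] X) ∘ₗ E.ofAlg H :=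
    TensorProduct.ext' h
  ext z
  exact congrFun ((E.denseRange_ofAlg H).equalizer f.continuous g.continuous
    (funext fun w => LinearMap.congr_fun hl w)) z

variable {E F : CStarCorr.{w, u} B} {H K : HilbRep.{w, u} B}

/-- The map `x ⊗ h ↦ V(x)h` of the algebraic tensor product is bounded by `M` with respect to the
norm of `E ⊗_σ H`. -/
def TensorBounded (M : ℝ) (V : E →ₗ[ℂ] (H →L[ℂ] K)) : Prop :=
  ∀ (n : ℕ) (x : Fin n → E) (h : Fin n → H),
    ‖∑ i, V (x i) (h i)‖ ≤ M * ‖E.ofAlg H (∑ i, x i ⊗ₜ[ℂ] h i)‖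

/-- The linear map `x ⊗ h ↦ V(x)h` on the algebraic tensor product. -/
def algLift (V : E →ₗ[ℂ] (H →L[ℂ] K)) : E ⊗[ℂ] H →ₗ[ℂ] K :=
  TensorProduct.lift (ContinuousLinearMap.coeLM ℂ ∘ₗ V)

lemma algLift_tmul (V : E →ₗ[ℂ] (H →L[ℂ] K)) (x : E) (h : H) : algLift V (x ⊗ₜ h) = V x h := rfl

lemma TensorBounded.norm_algLift_le {M : ℝ} {V : E →ₗ[ℂ] (H →L[ℂ] K)} (hV : TensorBounded M V)
    (z : E ⊗[ℂ] H) : ‖algLift V z‖ ≤ M * √‖(E.toPre.tensor H.toPre).form z z‖ := by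
  rw [← norm_ofAlg]
  obtain ⟨n, x, y, rfl⟩ := PreCorr.exists_fin_sum z
  rw [map_sum]
  exact hV n x y

/-- The operator `Ṽ : E ⊗_σ H → K`, `Ṽ(x ⊗ h) = V(x)h`. -/
def lift (V : E →ₗ[ℂ] (H →L[ℂ] K)) : E.tensorRep H →L[ℂ] K :=
  (E.toPre.tensor H.toPre).extend (algLift V)

lemma lift_ofAlg {M : ℝ} {V : E →ₗ[ℂ] (H →L[ℂ] K)} (hV : TensorBounded M V) (z : E ⊗[ℂ] H) :
    lift V (E.ofAlg H z) = algLift V z :=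
  PreCorr.extend_toCompl _ _ M hV.norm_algLift_le z

lemma lift_tmulRep {M : ℝ} {V : E →ₗ[ℂ] (H →L[ℂ] K)} (hV : TensorBounded M V) (x : E) (h : H) :
    lift V (E.tmulRep H x h) = V x h := lift_ofAlg hV _

/-- The operator `Ṽ` of a left module map `V`, as an operator intertwining the representations. -/
def liftHom {M : ℝ} (V : E →ₗ[ℂ] (H →L[ℂ] K)) (hV : TensorBounded M V)
    (hl : ∀ a x h, V (E.lact a x) h = K.rep a (V x h)) : HilbRep.Hom (E.tensorRep H) K where
  toCLM := lift V
  comm a z := by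
    have : (lift V) ∘L (E.tensorRep H).rep a = K.rep a ∘L lift V :=
      E.tensorRep_ext H fun x h => by
        simp only [ContinuousLinearMap.comp_apply]
        rw [rep_tmulRep, lift_tmulRep hV, lift_tmulRep hV, hl]
    exact congrArg (fun f => f z) this

lemma liftHom_tmulRep {M : ℝ} (V : E →ₗ[ℂ] (H →L[ℂ] K)) (hV : TensorBounded M V)
    (hl : ∀ a x h, V (E.lact a x) h = K.rep a (V x h)) (x : E) (h : H) :
    liftHom V hV hl (E.tmulRep H x h) = V x h := lift_tmulRep hV x h

/-- If `V(x)⋆V(y) = σ(⟨x, y⟩)` then `Ṽ` is an isometry. -/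
lemma tensorBounded_of_isometric (V : E →ₗ[ℂ] (H →L[ℂ] K))
    (hV : ∀ x y h k, inner ℂ (V x h) (V y k) = inner ℂ h (H.rep (E.ip x y) k)) :
    TensorBounded 1 V := by
  intro n x h
  rw [one_mul]
  refine le_of_eq ?_
  rw [← sq_eq_sq₀ (norm_nonneg _) (norm_nonneg _), ← Complex.ofReal_inj, norm_sq_ofAlg]
  have h1 : ((‖∑ i, V (x i) (h i)‖ ^ 2 : ℝ) : ℂ)
      = inner ℂ (∑ i, V (x i) (h i)) (∑ i, V (x i) (h i)) := by
    rw [inner_self_eq_norm_sq_to_K]; norm_cast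
  rw [h1]
  change _ = E.toPre.tensorForm H.toPre _ _
  rw [PreCorr.tensorForm_sum]
  simp only [sum_inner, inner_sum, hV]
  exact Finset.sum_comm

/-- Diagonal form of the norm of `E ⊗_σ H`. -/
lemma norm_sq_of_gram (E : CStarCorr.{w, u} B) (H : HilbRep.{w, u} B) {n : ℕ} (x : Fin n → E)
    (h : Fin n → H) (c : Fin n → Fin n → B)
    (hc : ∀ i j, E.ip (x i) (x j) = ∑ l, star (c l i) * c l j) :
    ‖E.ofAlg H (∑ i, x i ⊗ₜ[ℂ] h i)‖ ^ 2 = ∑ l, ‖∑ i, H.rep (c l i) (h i)‖ ^ 2 := by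
  rw [← Complex.ofReal_inj, norm_sq_ofAlg]
  change E.toPre.tensorForm H.toPre _ _ = _
  rw [PreCorr.tensorForm_eq_of_gram _ _ x h c hc, Complex.ofReal_sum]
  refine Finset.sum_congr rfl fun l _ => ?_
  rw [HilbRep.toPre_form, inner_self_eq_norm_sq_to_K]
  norm_cast

lemma norm_lTensor_alg_le (E : CStarCorr.{w, u} B) (X : HilbRep.Hom H K) (z : E ⊗[ℂ] H) :
    ‖E.ofAlg K (LinearMap.lTensor E (X.toCLM : H →ₗ[ℂ] K) z)‖
      ≤ ‖X.toCLM‖ * √‖(E.toPre.tensor H.toPre).form z z‖ := by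
  rw [← norm_ofAlg]
  obtain ⟨n, x, h, rfl⟩ := PreCorr.exists_fin_sum z
  obtain ⟨c, hc⟩ := E.toPre.exists_gram x
  rw [← sq_le_sq₀ (norm_nonneg _) (by positivity), mul_pow, norm_sq_of_gram E H x h c hc, map_sum]
  simp only [LinearMap.lTensor_tmul]
  rw [norm_sq_of_gram E K x _ c hc, Finset.mul_sum]
  refine Finset.sum_le_sum fun l _ => ?_
  have : ∑ i, K.rep (c l i) ((X.toCLM : H →ₗ[ℂ] K) (h i))
      = X.toCLM (∑ i, H.rep (c l i) (h i)) := by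
    rw [map_sum]
    exact Finset.sum_congr rfl fun i _ => (X.comm _ _).symm
  rw [this, ← mul_pow]
  gcongr
  exact X.toCLM.le_opNorm _

/-- The operator `I_E ⊗ X : E ⊗ H → E ⊗ K`, for `X` intertwining the representations. -/
def lTensor (E : CStarCorr.{w, u} B) (X : HilbRep.Hom H K) :
    HilbRep.Hom (E.tensorRep H) (E.tensorRep K) where
  toCLM := (E.toPre.tensor H.toPre).extend
    (E.ofAlg K ∘ₗ LinearMap.lTensor E (X.toCLM : H →ₗ[ℂ] K))
  comm a z := by
    set f : E.tensorRep H →L[ℂ] E.tensorRep K := (E.toPre.tensor H.toPre).extend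
      (E.ofAlg K ∘ₗ LinearMap.lTensor E (X.toCLM : H →ₗ[ℂ] K)) with hf
    have hft : ∀ x h, f (E.tmulRep H x h) = E.tmulRep K x (X h) := fun x h =>
      PreCorr.extend_toCompl _ _ _ (E.norm_lTensor_alg_le X) (x ⊗ₜ h)
    have : f ∘L (E.tensorRep H).rep a = (E.tensorRep K).rep a ∘L f :=
      E.tensorRep_ext H fun x h => by
        simp only [ContinuousLinearMap.comp_apply]
        rw [rep_tmulRep, hft, hft, rep_tmulRep]
    exact congrArg (fun f => f z) this

lemma lTensor_tmulRep (E : CStarCorr.{w, u} B) (X : HilbRep.Hom H K) (x : E) (h : H) :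
    E.lTensor X (E.tmulRep H x h) = E.tmulRep K x (X h) :=
  PreCorr.extend_toCompl _ _ _ (E.norm_lTensor_alg_le X) (x ⊗ₜ h)

lemma norm_tmulRep_le (E : CStarCorr.{w, u} B) (H : HilbRep.{w, u} B) (x : E) (h : H) :
    ‖E.tmulRep H x h‖ ≤ ‖x‖ * ‖h‖ := by
  rw [← sq_le_sq₀ (norm_nonneg _) (by positivity), mul_pow]
  have h1 : ‖E.tmulRep H x h‖ ^ 2 = ‖inner ℂ h (H.rep (E.ip x x) h)‖ := by
    rw [← inner_tmulRep, inner_self_eq_norm_sq_to_K]; simp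
  have h2 : ‖x‖ ^ 2 = ‖E.ip x x‖ := by rw [norm_eq, Real.sq_sqrt (norm_nonneg _)]
  rw [h1, h2]
  calc ‖inner ℂ h (H.rep (E.ip x x) h)‖ ≤ ‖h‖ * ‖H.rep (E.ip x x) h‖ := norm_inner_le_norm _ _
    _ ≤ ‖h‖ * (‖E.ip x x‖ * ‖h‖) := by
        gcongr
        refine ((H.rep (E.ip x x)).le_opNorm h).trans ?_
        gcongr
        exact NonUnitalStarAlgHom.norm_apply_le H.rep _
    _ = ‖E.ip x x‖ * ‖h‖ ^ 2 := by ring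

/-- The creation operators `x ↦ (h ↦ x ⊗ h)`. -/
def creation (E : CStarCorr.{w, u} B) (H : HilbRep.{w, u} B) :
    E →ₗ[ℂ] (H →L[ℂ] E.tensorRep H) where
  toFun x := LinearMap.mkContinuous
    { toFun := fun h => E.tmulRep H x h
      map_add' := fun h k => by simp [tmulRep, TensorProduct.tmul_add]
      map_smul' := fun r h => by simp [tmulRep] } ‖x‖ (E.norm_tmulRep_le H x)
  map_add' x y := by ext h; simp [tmulRep, TensorProduct.add_tmul]
  map_smul' r x := by
    ext h
    change E.ofAlg H ((r • x) ⊗ₜ[ℂ] h) = r • E.ofAlg H (x ⊗ₜ[ℂ] h)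
    rw [← map_smul]
    rfl

lemma creation_apply (E : CStarCorr.{w, u} B) (H : HilbRep.{w, u} B) (x : E) (h : H) :
    E.creation H x h = E.tmulRep H x h := rfl

/-- The map `y ↦ (h ↦ (x ⊗ y) ⊗ h)`. -/
def assocAux (E F : CStarCorr.{w, u} B) (H : HilbRep.{w, u} B) (x : E) :
    F →ₗ[ℂ] (H →L[ℂ] (E.tensor F).tensorRep H) :=
  (E.tensor F).creation H ∘ₗ (E.toPre.tensor F.toPre).toCompl ∘ₗ TensorProduct.mk ℂ E F x

lemma assocAux_apply (E F : CStarCorr.{w, u} B) (H : HilbRep.{w, u} B) (x : E) (y : F) (h : H) :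
    E.assocAux F H x y h = (E.tensor F).tmulRep H (E.tmul F x y) h := rfl

lemma inner_assocAux (E F : CStarCorr.{w, u} B) (H : HilbRep.{w, u} B) (x x' : E)
    (z z' : F ⊗[ℂ] H) :
    inner ℂ (algLift (E.assocAux F H x) z) (algLift (E.assocAux F H x') z')
      = inner ℂ (F.ofAlg H z) ((F.tensorRep H).rep (E.ip x x') (F.ofAlg H z')) := by
  induction z with
  | zero => simp
  | add a b ha hb => simp only [map_add, inner_add_left, ha, hb]
  | tmul y h =>
    induction z' with
    | zero => simp
    | add a b ha hb => simp only [map_add, inner_add_right, ha, hb]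
    | tmul y' h' =>
      rw [algLift_tmul, algLift_tmul, assocAux_apply, assocAux_apply, inner_tmulRep, ip_tmul]
      change _ = inner ℂ (F.tmulRep H y h) ((F.tensorRep H).rep (E.ip x x') (F.tmulRep H y' h'))
      rw [rep_tmulRep, inner_tmulRep]

lemma assocAux_bounded (E F : CStarCorr.{w, u} B) (H : HilbRep.{w, u} B) (x : E) :
    TensorBounded ‖x‖ (E.assocAux F H x) := by
  intro n y h
  have h0 : ∑ i, E.assocAux F H x (y i) (h i)
      = algLift (E.assocAux F H x) (∑ i, y i ⊗ₜ[ℂ] h i) := by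
    rw [map_sum]; rfl
  rw [h0]
  set z := ∑ i, y i ⊗ₜ[ℂ] h i
  have h2 : ‖x‖ ^ 2 = ‖E.ip x x‖ := by rw [norm_eq, Real.sq_sqrt (norm_nonneg _)]
  rw [← sq_le_sq₀ (norm_nonneg _) (by positivity), mul_pow, h2]
  have h1 : ‖algLift (E.assocAux F H x) z‖ ^ 2
      = ‖inner ℂ (F.ofAlg H z) ((F.tensorRep H).rep (E.ip x x) (F.ofAlg H z))‖ := by
    rw [← inner_assocAux, inner_self_eq_norm_sq_to_K]; simp
  rw [h1]
  calc _ ≤ ‖F.ofAlg H z‖ * ‖(F.tensorRep H).rep (E.ip x x) (F.ofAlg H z)‖ :=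
        norm_inner_le_norm _ _
    _ ≤ ‖F.ofAlg H z‖ * (‖E.ip x x‖ * ‖F.ofAlg H z‖) := by
        gcongr
        refine (((F.tensorRep H).rep (E.ip x x)).le_opNorm _).trans ?_
        gcongr
        exact NonUnitalStarAlgHom.norm_apply_le (F.tensorRep H).rep _
    _ = ‖E.ip x x‖ * ‖F.ofAlg H z‖ ^ 2 := by ring

/-- The family `x ↦ (y ⊗ h ↦ (x ⊗ y) ⊗ h)`. -/
def assocFamily (E F : CStarCorr.{w, u} B) (H : HilbRep.{w, u} B) :
    E →ₗ[ℂ] (F.tensorRep H →L[ℂ] (E.tensor F).tensorRep H) where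
  toFun x := lift (E.assocAux F H x)
  map_add' x x' := F.tensorRep_ext H fun y h => by
    rw [_root_.add_apply, lift_tmulRep (E.assocAux_bounded F H _),
      lift_tmulRep (E.assocAux_bounded F H _), lift_tmulRep (E.assocAux_bounded F H _)]
    change (E.tensor F).creation H (E.tmul F (x + x') y) h
      = (E.tensor F).creation H (E.tmul F x y) h + (E.tensor F).creation H (E.tmul F x' y) h
    rw [← _root_.add_apply, ← map_add]
    congr 2
    exact ((E.toPre.tensor F.toPre).toCompl ∘ₗ (TensorProduct.mk ℂ E F).flip y).map_add x x'
  map_smul' r x := F.tensorRep_ext H fun y h => by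
    rw [_root_.smul_apply, lift_tmulRep (E.assocAux_bounded F H _),
      lift_tmulRep (E.assocAux_bounded F H _)]
    change (E.tensor F).creation H (E.tmul F (r • x) y) h
      = r • (E.tensor F).creation H (E.tmul F x y) h
    rw [← _root_.smul_apply, ← map_smul]
    congr 2
    exact ((E.toPre.tensor F.toPre).toCompl ∘ₗ (TensorProduct.mk ℂ E F).flip y).map_smul r x

lemma assocFamily_apply (E F : CStarCorr.{w, u} B) (H : HilbRep.{w, u} B) (x : E) (y : F) (h : H) :
    E.assocFamily F H x (F.tmulRep H y h) = (E.tensor F).tmulRep H (E.tmul F x y) h :=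
  lift_tmulRep (E.assocAux_bounded F H x) y h

lemma assocFamily_isometric (E F : CStarCorr.{w, u} B) (H : HilbRep.{w, u} B) (x x' : E)
    (k k' : F.tensorRep H) :
    inner ℂ (E.assocFamily F H x k) (E.assocFamily F H x' k')
      = inner ℂ k ((F.tensorRep H).rep (E.ip x x') k') := by
  refine (F.toPre.tensor H.toPre).compl_ext₂
    (f := fun k k' => inner ℂ (E.assocFamily F H x k) (E.assocFamily F H x' k'))
    (g := fun k k' => inner ℂ k ((F.tensorRep H).rep (E.ip x x') k')) ?_ ?_ (fun z z' => ?_) k k'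
  · unfold Function.uncurry
    exact ((E.assocFamily F H x).continuous.comp continuous_fst).inner
      ((E.assocFamily F H x').continuous.comp continuous_snd)
  · unfold Function.uncurry
    exact continuous_fst.inner (((F.tensorRep H).rep _).continuous.comp continuous_snd)
  · have e : ∀ x z, E.assocFamily F H x (F.ofAlg H z) = algLift (E.assocAux F H x) z :=
      fun x z => lift_ofAlg (E.assocAux_bounded F H x) z
    change inner ℂ (E.assocFamily F H x (F.ofAlg H z)) (E.assocFamily F H x' (F.ofAlg H z')) = _
    rw [e, e, inner_assocAux]
    rfl

/-- The canonical unitary `E ⊗ (F ⊗ H) → (E ⊗_B F) ⊗ H`, `x ⊗ (y ⊗ h) ↦ (x ⊗ y) ⊗ h`. -/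
def assoc (E F : CStarCorr.{w, u} B) (H : HilbRep.{w, u} B) :
    HilbRep.Hom (E.tensorRep (F.tensorRep H)) ((E.tensor F).tensorRep H) :=
  liftHom (E.assocFamily F H) (tensorBounded_of_isometric _ (E.assocFamily_isometric F H))
    fun a x k => by
      have : E.assocFamily F H (E.lact a x)
          = ((E.tensor F).tensorRep H).rep a ∘L E.assocFamily F H x :=
        F.tensorRep_ext H fun y h => by
          rw [ContinuousLinearMap.comp_apply, assocFamily_apply, assocFamily_apply, rep_tmulRep,
            lact_tmul]
      exact congrArg (fun f => f k) this

lemma assoc_tmul (E F : CStarCorr.{w, u} B) (H : HilbRep.{w, u} B) (x : E) (y : F) (h : H) :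
    E.assoc F H (E.tmulRep _ x (F.tmulRep H y h)) = (E.tensor F).tmulRep H (E.tmul F x y) h :=
  (liftHom_tmulRep _ _ _ _ _).trans (E.assocFamily_apply F H x y h)

/-- Unitary isomorphisms of C⋆-correspondences: surjective maps preserving the `B`-valued inner
product (hence right `B`-linear) and commuting with the left actions. -/
structure Iso (E F : CStarCorr.{w, u} B) where
  toEquiv : E ≃ₗ[ℂ] F
  ip_map : ∀ x y, F.ip (toEquiv x) (toEquiv y) = E.ip x y
  lact_map : ∀ a x, toEquiv (E.lact a x) = F.lact a (toEquiv x)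

/-- The identity isomorphism. -/
def Iso.refl (E : CStarCorr.{w, u} B) : E.Iso E := ⟨.refl ℂ E, fun _ _ => rfl, fun _ _ => rfl⟩

/-- The inverse isomorphism. -/
def Iso.symm (t : E.Iso F) : F.Iso E where
  toEquiv := t.toEquiv.symm
  ip_map x y := by rw [← t.ip_map]; simp
  lact_map a x := by
    rw [LinearEquiv.symm_apply_eq, t.lact_map]; simp

lemma Iso.map_ract (t : E.Iso F) (x : E) (b : B) :
    t.toEquiv (E.ract x b) = F.ract (t.toEquiv x) b :=
  F.ext_ip fun z => by
    obtain ⟨z, rfl⟩ := t.toEquiv.surjective z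
    rw [t.ip_map, ip_ract, ip_ract, t.ip_map]

/-- The operator `t ⊗ I_H : E ⊗ H → F ⊗ H`. -/
def rTensor (t : E.Iso F) (H : HilbRep.{w, u} B) :
    HilbRep.Hom (E.tensorRep H) (F.tensorRep H) :=
  liftHom (F.creation H ∘ₗ (t.toEquiv : E →ₗ[ℂ] F))
    (tensorBounded_of_isometric _ fun x y h k => by
      change inner ℂ (F.tmulRep H (t.toEquiv x) h) (F.tmulRep H (t.toEquiv y) k) = _
      rw [inner_tmulRep, t.ip_map])
    fun a x h => by
      change F.tmulRep H (t.toEquiv (E.lact a x)) h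
        = (F.tensorRep H).rep a (F.tmulRep H (t.toEquiv x) h)
      rw [rep_tmulRep, t.lact_map]

lemma rTensor_tmulRep (t : E.Iso F) (H : HilbRep.{w, u} B) (x : E) (h : H) :
    rTensor t H (E.tmulRep H x h) = F.tmulRep H (t.toEquiv x) h := liftHom_tmulRep _ _ _ x h

/-- For `t : E ⊗_B F → F ⊗_B E`, the operator `t ⊗ I_H`, read as an operator
`E ⊗ (F ⊗ H) → F ⊗ (E ⊗ H)` through the associativity unitaries. -/
def flip (t : (E.tensor F).Iso (F.tensor E)) (H : HilbRep.{w, u} B) :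
    HilbRep.Hom (E.tensorRep (F.tensorRep H)) (F.tensorRep (E.tensorRep H)) :=
  (F.assoc E H).adjoint.comp ((rTensor t H).comp (E.assoc F H))

end CStarCorr

namespace CStarCorr

variable {E F : CStarCorr.{w, u} B} {H K : HilbRep.{w, u} B}

lemma contraction_liftHom (V : E →ₗ[ℂ] (H →L[ℂ] K)) (hV : TensorBounded 1 V)
    (hl : ∀ a x h, V (E.lact a x) h = K.rep a (V x h)) : (liftHom V hV hl).Contraction := by
  intro z
  refine DenseRange.induction_on (p := fun z => ‖lift V z‖ ≤ ‖z‖) (E.denseRange_ofAlg H) z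
    (isClosed_le (lift V).continuous.norm continuous_norm) fun z => ?_
  rw [lift_ofAlg hV]
  have := hV.norm_algLift_le z
  rwa [← norm_ofAlg, one_mul] at this

lemma contraction_lTensor {X : HilbRep.Hom H K} (hX : X.Contraction) :
    (E.lTensor X).Contraction := by
  have h1 : ‖X.toCLM‖ ≤ 1 :=
    ContinuousLinearMap.opNorm_le_bound _ zero_le_one fun y => by rw [one_mul]; exact hX y
  intro z
  refine DenseRange.induction_on (p := fun z => ‖(E.lTensor X).toCLM z‖ ≤ ‖z‖)
    (E.denseRange_ofAlg H) z
    (isClosed_le (E.lTensor X).toCLM.continuous.norm continuous_norm) fun z => ?_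
  have e : (E.lTensor X).toCLM (E.ofAlg H z)
      = E.ofAlg K (LinearMap.lTensor E (X.toCLM : H →ₗ[ℂ] K) z) :=
    PreCorr.extend_toCompl _ _ _ (E.norm_lTensor_alg_le X) z
  rw [e]
  refine (E.norm_lTensor_alg_le X z).trans ?_
  rw [← norm_ofAlg]
  exact mul_le_of_le_one_left (norm_nonneg _) h1

lemma contraction_flip (t : (E.tensor F).Iso (F.tensor E)) (H : HilbRep.{w, u} B) :
    (flip t H).Contraction :=
  (contraction_liftHom _ _ _).adjoint.comp
    ((contraction_liftHom _ _ _).comp (contraction_liftHom _ _ _))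

section SumShift

variable {ι : Type} (G : ι → HilbRep.{w, u} B) (s : ι → ι)
  (hs : Function.Injective s) (X : ∀ n, HilbRep.Hom (E.tensorRep (G n)) (G (s n)))
  (hX : ∀ n, (X n).Contraction)

/-- The operator `⊕ₙ G n → ⊕ₙ G (s n)` which is `h ↦ X n (ξ ⊗ h)` on `G n`. -/
def sumDiag : E →ₗ[ℂ] (HilbRep.dsum G →L[ℂ] HilbRep.dsum fun n => G (s n)) where
  toFun ξ := HilbRep.diag (fun n => (X n).toCLM ∘L E.creation _ ξ) ‖ξ‖
    fun n x => (hX n _).trans (E.norm_tmulRep_le _ ξ x)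
  map_add' ξ η := by
    refine ContinuousLinearMap.ext fun f => lp.ext (funext fun n => ?_)
    change (X n).toCLM (E.creation _ (ξ + η) (HilbRep.coord f n))
      = (X n).toCLM (E.creation _ ξ (HilbRep.coord f n))
        + (X n).toCLM (E.creation _ η (HilbRep.coord f n))
    rw [map_add, _root_.add_apply, map_add]
  map_smul' r ξ := by
    refine ContinuousLinearMap.ext fun f => lp.ext (funext fun n => ?_)
    change (X n).toCLM (E.creation _ (r • ξ) (HilbRep.coord f n))
      = r • (X n).toCLM (E.creation _ ξ (HilbRep.coord f n))
    rw [map_smul, _root_.smul_apply, map_smul]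

lemma sumDiag_lact (a : B) (ξ : E) (f : HilbRep.dsum G) :
    sumDiag G s X hX (E.lact a ξ) f
      = (HilbRep.dsum fun n => G (s n)).rep a (sumDiag G s X hX ξ f) := by
  refine lp.ext (funext fun n => ?_)
  change X n (E.tmulRep _ (E.lact a ξ) (HilbRep.coord f n))
    = (G (s n)).rep a (X n (E.tmulRep _ ξ (HilbRep.coord f n)))
  rw [← HilbRep.Hom.comm, rep_tmulRep]

variable [DecidableEq ι]

/-- The operators on `⊕ₙ G n`, indexed by `ξ ∈ E`, which map the summand `G n` into the summand
`G (s n)` by `h ↦ X n (ξ ⊗ h)`. -/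
def sumShift : E →ₗ[ℂ] (HilbRep.dsum G →L[ℂ] HilbRep.dsum G) where
  toFun ξ := (HilbRep.reindex G s hs).toCLM ∘L sumDiag G s X hX ξ
  map_add' ξ η := by rw [map_add, ContinuousLinearMap.comp_add]
  map_smul' r ξ := by rw [map_smul, ContinuousLinearMap.comp_smul]; rfl

lemma sumShift_lact (a : B) (ξ : E) (f : HilbRep.dsum G) :
    sumShift G s hs X hX (E.lact a ξ) f
      = (HilbRep.dsum G).rep a (sumShift G s hs X hX ξ f) := by
  change HilbRep.reindex G s hs (sumDiag G s X hX (E.lact a ξ) f)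
    = (HilbRep.dsum G).rep a (HilbRep.reindex G s hs (sumDiag G s X hX ξ f))
  rw [sumDiag_lact, HilbRep.Hom.comm]

lemma sumShift_tensorBounded : TensorBounded 1 (sumShift G s hs X hX) := by
  intro m ξ f
  rw [one_mul, ← sq_le_sq₀ (norm_nonneg _) (norm_nonneg _)]
  obtain ⟨c, hc⟩ := E.toPre.exists_gram ξ
  rw [norm_sq_of_gram E (HilbRep.dsum G) ξ f c hc]
  have e1 : ∑ j, sumShift G s hs X hX (ξ j) (f j)
      = HilbRep.reindex G s hs (∑ j, sumDiag G s X hX (ξ j) (f j)) := by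
    rw [map_sum]; rfl
  rw [e1, HilbRep.norm_reindex]
  have hcoord : ∀ (G : ι → HilbRep.{w, u} B) (g : Fin m → HilbRep.dsum G) (n : ι),
      HilbRep.coord (∑ j, g j) n = ∑ j, HilbRep.coord (g j) n := fun G g n =>
    (congrFun (lp.coeFn_sum (E := fun n => G n) (p := 2) g Finset.univ) n).trans
      (Finset.sum_apply _ _ _)
  have hsq : ∀ (G : ι → HilbRep.{w, u} B) (g : HilbRep.dsum G),
      ‖g‖ ^ 2 = ∑' n, ‖HilbRep.coord g n‖ ^ 2 := fun G g => HilbRep.norm_sq_lp g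
  have hsum : ∀ (G : ι → HilbRep.{w, u} B) (g : HilbRep.dsum G),
      Summable fun n => ‖HilbRep.coord g n‖ ^ 2 := fun G g => HilbRep.summable_norm_sq g
  have h0 : ∑ l, ‖∑ j, (HilbRep.dsum G).rep (c l j) (f j)‖ ^ 2
      = ∑' n, ∑ l, ‖HilbRep.coord (∑ j, (HilbRep.dsum G).rep (c l j) (f j)) n‖ ^ 2 := by
    rw [Summable.tsum_finsetSum fun l _ => hsum _ _]
    exact Finset.sum_congr rfl fun l _ => hsq _ _
  rw [h0, hsq]
  refine Summable.tsum_le_tsum (fun n => ?_) (hsum _ _) (summable_sum fun l _ => hsum _ _)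
  have e2 : HilbRep.coord (∑ j, sumDiag G s X hX (ξ j) (f j)) n
      = X n (E.ofAlg _ (∑ j, ξ j ⊗ₜ[ℂ] HilbRep.coord (f j) n)) := by
    rw [hcoord, map_sum, map_sum]
    rfl
  have e3 : ∀ l, HilbRep.coord (∑ j, (HilbRep.dsum G).rep (c l j) (f j)) n
      = ∑ j, (G n).rep (c l j) (HilbRep.coord (f j) n) := fun l => by
    rw [hcoord]
    rfl
  rw [e2]
  simp only [e3]
  rw [← norm_sq_of_gram E _ ξ _ c hc]
  exact pow_le_pow_left₀ (norm_nonneg _) (hX n _) 2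

end SumShift

end CStarCorr

/-! ### Completely contractive covariant representations of a correspondence -/

/-- Functional calculus elements used to compare a row operator with its Gram matrix. -/
lemma exists_sqrt_approx {M : Type*} [NonUnitalCStarAlgebra M] [PartialOrder M]
    [StarOrderedRing M] (c : M) {δ : ℝ} (hδ : 0 < δ) :
    ∃ f s g : M, g = f * s ∧ ‖star f * (star c * c) * f‖ ≤ 1 ∧ star s * s = star c * c ∧
      ‖star c * c - (star c * c) * g - star g * (star c * c)
        + star g * (star c * c) * g‖ ≤ δ := by
  obtain ⟨G, hGdef⟩ : ∃ G, G = star c * c := ⟨_, rfl⟩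
  rw [← hGdef]
  have hG0 : 0 ≤ G := hGdef ▸ star_mul_self_nonneg c
  have hGs : IsSelfAdjoint G := .of_nonneg hG0
  have hden : ∀ t : ℝ, |t| + δ ≠ 0 := fun t => by positivity
  let φ : ℝ → ℝ := fun t => √t / (|t| + δ)
  let ψ : ℝ → ℝ := fun t => √t
  let γ : ℝ → ℝ := fun t => √t / (|t| + δ) * √t
  have hφc : Continuous φ := by
    apply Continuous.div (by fun_prop) (by fun_prop) hden
  have hψc : Continuous ψ := by fun_prop
  have hγc : Continuous γ := hφc.mul hψc
  have hφ0 : φ 0 = 0 := by simp [φ]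
  have hψ0 : ψ 0 = 0 := by simp [ψ]
  have hγ0 : γ 0 = 0 := by simp [γ]
  have sφ : star (cfcₙ φ G) = cfcₙ φ G := (IsSelfAdjoint.cfcₙ (f := φ) (a := G)).star_eq
  have sψ : star (cfcₙ ψ G) = cfcₙ ψ G := (IsSelfAdjoint.cfcₙ (f := ψ) (a := G)).star_eq
  have sγ : star (cfcₙ γ G) = cfcₙ γ G := (IsSelfAdjoint.cfcₙ (f := γ) (a := G)).star_eq
  have hid : G = cfcₙ (fun t : ℝ => t) G := (cfcₙ_id' ℝ G).symm
  have hspec : ∀ t ∈ quasispectrum ℝ G, 0 ≤ t := fun t ht =>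
    quasispectrum_nonneg_of_nonneg G hG0 t ht
  have hγe : ∀ t, 0 ≤ t → γ t = t / (t + δ) := fun t ht => by
    simp only [γ]
    rw [abs_of_nonneg ht, div_mul_eq_mul_div, Real.mul_self_sqrt ht]
  refine ⟨cfcₙ φ G, cfcₙ ψ G, cfcₙ γ G, ?_, ?_, ?_, ?_⟩
  · rw [← cfcₙ_mul φ ψ G hφc.continuousOn hφ0 hψc.continuousOn hψ0]
  · rw [sφ]
    have e : cfcₙ φ G * G * cfcₙ φ G = cfcₙ (fun t => φ t * t * φ t) G := by
      rw [cfcₙ_mul (fun t => φ t * t) φ G (hφc.mul continuous_id).continuousOn (by simp)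
        hφc.continuousOn hφ0, cfcₙ_mul φ (fun t => t) G hφc.continuousOn hφ0
        continuous_id.continuousOn rfl, ← hid]
    rw [e]
    refine norm_cfcₙ_le fun t ht => ?_
    have ht0 := hspec t ht
    have : φ t * t * φ t = (t / (t + δ)) ^ 2 := by
      simp only [φ]
      rw [abs_of_nonneg ht0]
      have := Real.mul_self_sqrt ht0
      field_simp
      linear_combination t * this
    rw [this, Real.norm_of_nonneg (by positivity)]
    have h1 : t / (t + δ) ≤ 1 := by rw [div_le_one (by positivity)]; linarith
    exact pow_le_one₀ (by positivity) h1
  · rw [sψ, ← cfcₙ_mul ψ ψ G hψc.continuousOn hψ0 hψc.continuousOn hψ0]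
    conv_rhs => rw [hid]
    exact cfcₙ_congr fun t ht => Real.mul_self_sqrt (hspec t ht)
  · rw [sγ]
    have e1 : G * cfcₙ γ G = cfcₙ (fun t => t * γ t) G := by
      rw [cfcₙ_mul (fun t => t) γ G continuous_id.continuousOn rfl hγc.continuousOn hγ0, ← hid]
    have e2 : cfcₙ γ G * G = cfcₙ (fun t => γ t * t) G := by
      rw [cfcₙ_mul γ (fun t => t) G hγc.continuousOn hγ0 continuous_id.continuousOn rfl, ← hid]
    have e3 : cfcₙ γ G * G * cfcₙ γ G = cfcₙ (fun t => γ t * t * γ t) G := by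
      rw [cfcₙ_mul (fun t => γ t * t) γ G (hγc.mul continuous_id).continuousOn (by simp)
        hγc.continuousOn hγ0, ← e2]
    have e : G - G * cfcₙ γ G - cfcₙ γ G * G + cfcₙ γ G * G * cfcₙ γ G
        = cfcₙ (fun t => t - t * γ t - γ t * t + γ t * t * γ t) G := by
      rw [e3, e1, e2]
      rw [cfcₙ_add (fun t => t - t * γ t - γ t * t) (fun t => γ t * t * γ t) G
          (by fun_prop) (by simp) (by fun_prop) (by simp),
        cfcₙ_sub (fun t => t - t * γ t) (fun t => γ t * t) G
          (by fun_prop) (by simp) (by fun_prop) (by simp),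
        cfcₙ_sub (fun t => t) (fun t => t * γ t) G
          (by fun_prop) (by simp) (by fun_prop) (by simp), ← hid]
    rw [e]
    refine norm_cfcₙ_le fun t ht => ?_
    have ht0 := hspec t ht
    have h2 : t - t * γ t - γ t * t + γ t * t * γ t = t * δ ^ 2 / (t + δ) ^ 2 := by
      rw [hγe t ht0]
      field_simp
      ring
    rw [h2, Real.norm_of_nonneg (by positivity), div_le_iff₀ (by positivity)]
    nlinarith [mul_nonneg ht0 hδ.le, mul_nonneg (mul_nonneg ht0 hδ.le) hδ.le,
      mul_nonneg (mul_nonneg ht0 ht0) hδ.le, pow_pos hδ 3]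

namespace CStarCorr

variable {E : CStarCorr.{w, u} B} {H K : HilbRep.{w, u} B}

/-- The `M_n(B)`-valued inner square `[∑ₗ ⟨x_{li}, x_{lj}⟩]_{ij}` of a matrix over `E`. The norm of
`M_n(E)` is the square root of the norm of this element of the C⋆-algebra `M_n(B)`. -/
def matrixGram {n : ℕ} (x : Fin n → Fin n → E) : CStarMatrix (Fin n) (Fin n) B :=
  CStarMatrix.ofMatrix fun i j => ∑ l, E.ip (x l i) (x l j)

/-- `V : E → B(H, K)` is completely contractive: for every `n`, the operator `[V(x_{ij})]` from
`Hⁿ` to `Kⁿ` has norm at most the norm of `[x_{ij}]` in `M_n(E)`. -/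
def CompletelyContractive (V : E →ₗ[ℂ] (H →L[ℂ] K)) : Prop :=
  ∀ (n : ℕ) (x : Fin n → Fin n → E) (h : Fin n → H),
    ∑ i, ‖∑ j, V (x i j) (h j)‖ ^ 2 ≤ ‖matrixGram x‖ * ∑ j, ‖h j‖ ^ 2

lemma CompletelyContractive.row {V : E →ₗ[ℂ] (H →L[ℂ] K)} (hV : CompletelyContractive V) {n : ℕ}
    (x : Fin n → E) (h : Fin n → H) :
    ‖∑ j, V (x j) (h j)‖ ^ 2
      ≤ ‖(CStarMatrix.ofMatrix fun i j => E.ip (x i) (x j) : CStarMatrix (Fin n) (Fin n) B)‖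
        * ∑ j, ‖h j‖ ^ 2 := by
  rcases n with _ | n
  · simp
  have := hV (n + 1) (fun i j => if i = 0 then x j else 0) h
  have e1 : ∑ i : Fin (n + 1), ‖∑ j, V (if i = 0 then x j else 0) (h j)‖ ^ 2
      = ‖∑ j, V (x j) (h j)‖ ^ 2 := by
    rw [Finset.sum_eq_single 0]
    · simp
    · intro i _ hi
      simp [hi]
    · simp
  have e2 : matrixGram (fun i j : Fin (n + 1) => if i = 0 then x j else 0)
      = CStarMatrix.ofMatrix fun i j => E.ip (x i) (x j) := by
    ext i j
    change ∑ l : Fin (n + 1), E.ip (if l = 0 then x i else 0) (if l = 0 then x j else 0)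
      = E.ip (x i) (x j)
    rw [Finset.sum_eq_single 0]
    · simp
    · intro l _ hl
      simp [hl, ip]
    · simp
  rwa [e1, e2] at this

/-- For a completely contractive right module map `V`, the operator `Ṽ` is a contraction. -/
lemma CompletelyContractive.tensorBounded {V : E →ₗ[ℂ] (H →L[ℂ] K)}
    (hV : CompletelyContractive V)
    (hr : ∀ x b, V (E.ract x b) = V x ∘L H.rep b) : TensorBounded 1 V := by
  intro n x h
  rw [one_mul]
  set p := E.toPre with hp
  obtain ⟨c₀, hc₀⟩ := p.exists_gram x
  let c : CStarMatrix (Fin n) (Fin n) B := CStarMatrix.ofMatrix c₀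
  have hG : ∀ i j, (star c * c) i j = p.form (x i) (x j) := fun i j => by
    rw [hc₀, CStarMatrix.mul_apply]; rfl
  have hVr : ∀ x b k, V (p.ract b x) k = V x (H.rep b k) := fun x b k => by
    have := hr x b
    exact congrArg (fun f => f k) this
  set N := ∑ j, ‖h j‖ ^ 2 with hN
  have hN0 : 0 ≤ N := Finset.sum_nonneg fun _ _ => by positivity
  have key : ∀ δ : ℝ, 0 < δ →
      ‖∑ i, V (x i) (h i)‖ ≤ √(δ * N) + ‖E.ofAlg H (∑ i, x i ⊗ₜ[ℂ] h i)‖ := by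
    intro δ hδ
    obtain ⟨f, s, g, hg, hf, hs, hgG⟩ := exists_sqrt_approx c hδ
    -- the rows `x f` and `x g`
    let xm : CStarMatrix (Fin n) (Fin n) B → Fin n → E := fun m j => ∑ i, p.ract (m i j) (x i)
    have hxm : ∀ m (k : Fin n → H), ∑ j, V (xm m j) (k j)
        = ∑ i, V (x i) (∑ j, H.rep (m i j) (k j)) := by
      intro m k
      simp only [xm, map_sum, _root_.sum_apply, hVr]
      exact Finset.sum_comm
    have gram_f : (CStarMatrix.ofMatrix fun i j => E.ip (xm f i) (xm f j) :
        CStarMatrix (Fin n) (Fin n) B) = star f * (star c * c) * f := by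
      ext i j
      change p.form (xm f i) (xm f j) = _
      simp only [xm, CStarMatrix.mul_apply (M := star f * (star c * c)),
        CStarMatrix.mul_apply (M := star f), hG, map_sum, LinearMap.sum_apply, p.form_ract,
        p.form_ract_left, Finset.sum_mul]
      rfl
    have gram_g : (CStarMatrix.ofMatrix fun i j => E.ip (x i - xm g i) (x j - xm g j) :
        CStarMatrix (Fin n) (Fin n) B) = star c * c - (star c * c) * g - star g * (star c * c)
        + star g * (star c * c) * g := by
      ext i j
      change p.form (x i - xm g i) (x j - xm g j) = _
      simp only [xm, CStarMatrix.add_apply, CStarMatrix.sub_apply,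
        CStarMatrix.mul_apply (M := star g * (star c * c)),
        CStarMatrix.mul_apply (M := star c * c),
        CStarMatrix.mul_apply (M := star g), hG, map_sub, LinearMap.sub_apply, map_sum,
        LinearMap.sum_apply, p.form_ract, p.form_ract_left, Finset.sum_mul, Finset.sum_sub_distrib]
      have : ∀ k, star (g k i) = (star g) i k := fun _ => rfl
      simp only [this]
      abel
    have h1 : ‖∑ j, V (x j - xm g j) (h j)‖ ≤ √(δ * N) := by
      refine Real.le_sqrt_of_sq_le ((hV.row _ h).trans ?_)
      rw [gram_g]
      gcongr
    have h2 : ‖∑ j, V (xm g j) (h j)‖ ≤ ‖E.ofAlg H (∑ i, x i ⊗ₜ[ℂ] h i)‖ := by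
      rw [← sq_le_sq₀ (norm_nonneg _) (norm_nonneg _),
        norm_sq_of_gram E H x h (fun l i => s l i) fun i j => by
          have := hG i j
          rw [← hs, CStarMatrix.mul_apply] at this
          exact this.symm]
      have e : ∑ j, V (xm g j) (h j) = ∑ l, V (xm f l) (∑ j, H.rep (s l j) (h j)) := by
        rw [hxm, hxm]
        refine Finset.sum_congr rfl fun i _ => congrArg _ ?_
        simp only [hg, CStarMatrix.mul_apply, map_sum, map_mul, _root_.sum_apply]
        exact Finset.sum_comm
      rw [e]
      refine (hV.row _ _).trans ?_
      rw [gram_f]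
      exact mul_le_of_le_one_left (Finset.sum_nonneg fun _ _ => by positivity) hf
    have e : ∑ i, V (x i) (h i) = ∑ j, V (x j - xm g j) (h j) + ∑ j, V (xm g j) (h j) := by
      rw [← Finset.sum_add_distrib]
      simp
    rw [e]
    exact (norm_add_le _ _).trans (add_le_add h1 h2)
  have hlim : Tendsto (fun δ : ℝ => √(δ * N) + ‖E.ofAlg H (∑ i, x i ⊗ₜ[ℂ] h i)‖) (𝓝[>] 0)
      (𝓝 (√(0 * N) + ‖E.ofAlg H (∑ i, x i ⊗ₜ[ℂ] h i)‖)) :=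
    (Continuous.tendsto (by fun_prop) 0).mono_left nhdsWithin_le_nhds
  rw [zero_mul, Real.sqrt_zero, zero_add] at hlim
  exact ge_of_tendsto hlim (eventually_nhdsWithin_of_forall fun δ hδ => key δ hδ)

/-- A completely contractive covariant representation `(σ, V)` of `E`, where `σ` is the
representation of `B` on the Hilbert space of `H`. -/
structure CCRep (E : CStarCorr.{w, u} B) (H : HilbRep.{w, u} B) where
  V : E →ₗ[ℂ] (H →L[ℂ] H)
  map_lact : ∀ (a : B) (x : E), V (E.lact a x) = H.rep a ∘L V x
  map_ract : ∀ (x : E) (b : B), V (E.ract x b) = V x ∘L H.rep b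
  completelyContractive : CompletelyContractive V

/-- The operator `Ṽ : E ⊗_σ H → H`, `Ṽ(x ⊗ h) = V(x)h`. -/
def CCRep.tilde (V : E.CCRep H) : HilbRep.Hom (E.tensorRep H) H :=
  liftHom V.V (V.completelyContractive.tensorBounded V.map_ract)
    fun a x h => by rw [V.map_lact]; rfl

lemma CCRep.tilde_tmulRep (V : E.CCRep H) (x : E) (h : H) :
    V.tilde (E.tmulRep H x h) = V.V x h := liftHom_tmulRep _ _ _ x h

end CStarCorr

/-! ### Product systems over `ℕᵏ` -/

/-- A product system over `ℕᵏ` of C⋆-correspondences over `B`: correspondences `E₁, …, E_k` and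
unitary isomorphisms `t i j : E i ⊗ E j → E j ⊗ E i` with `t i i = id` and
`t j i = (t i j)⁻¹`. -/
structure ProductSystem (B : Type w) [NonUnitalCStarAlgebra B] [PartialOrder B]
    [StarOrderedRing B] (k : ℕ) where
  E : Fin k → CStarCorr.{w, u} B
  t : ∀ i j, ((E i).tensor (E j)).Iso ((E j).tensor (E i))
  t_self : ∀ i, t i i = CStarCorr.Iso.refl _
  t_symm : ∀ i j, t j i = (t i j).symm

/-- The word `1 ⋯ 1 2 ⋯ 2 ⋯ k ⋯ k` in which the letter `i` occurs `n i` times. -/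
def multiWord {k : ℕ} (n : Fin k → ℕ) : List (Fin k) :=
  (List.finRange k).flatMap fun i => List.replicate (n i) i

lemma count_multiWord {k : ℕ} (n : Fin k → ℕ) (i : Fin k) : (multiWord n).count i = n i := by
  rw [multiWord, List.count_flatMap]
  have : (List.map (List.count i ∘ fun j => List.replicate (n j) j) (List.finRange k)).sum
      = ((List.finRange k).map fun j => if j = i then n j else 0).sum := by
    congr 2
    funext j
    simp [List.count_replicate]
  rw [this, ← Fin.sum_univ_def]
  simp

lemma pairwise_multiWord {k : ℕ} (n : Fin k → ℕ) : (multiWord n).Pairwise (· ≤ ·) := by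
  rw [multiWord, List.pairwise_flatMap]
  refine ⟨fun i _ => by simp [List.pairwise_replicate], ?_⟩
  refine (List.pairwise_lt_finRange k).imp fun {i j} hij x hx y hy => ?_
  rw [List.eq_of_mem_replicate hx, List.eq_of_mem_replicate hy]
  exact hij.le

/-- Raising the `i`-th exponent inserts a letter `i` after all smaller letters. -/
lemma multiWord_add {k : ℕ} (n : Fin k → ℕ) (i : Fin k) :
    multiWord (n + Pi.single i 1) = (multiWord n).takeWhile (fun j => ¬ i ≤ j)
      ++ i :: (multiWord n).dropWhile (fun j => ¬ i ≤ j) := by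
  rw [← List.orderedInsert_eq_take_drop]
  refine List.Perm.eq_of_pairwise' (pairwise_multiWord _)
    ((pairwise_multiWord n).orderedInsert i _) ?_
  refine List.Perm.trans ?_ (List.perm_orderedInsert _ _ _).symm
  rw [List.perm_iff_count]
  intro j
  rw [count_multiWord, List.count_cons, count_multiWord, Pi.add_apply]
  by_cases h : i = j
  · subst h; simp
  · rw [Pi.single_eq_of_ne (Ne.symm h)]; simp [h]

namespace ProductSystem

variable {k : ℕ} (𝔼 : ProductSystem.{w, u} B k)

/-- The space `E(w) ⊗ H = E_{i₁} ⊗ (E_{i₂} ⊗ (⋯ ⊗ H))` for a word `w = i₁ i₂ ⋯`, with the induced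
representation of `B`. For the empty word this is `H`. -/
def word : List (Fin k) → HilbRep.{w, u} B → HilbRep.{w, u} B
  | [], H => H
  | i :: w, H => (𝔼.E i).tensorRep (word w H)

/-- The operator `I_{E(w)} ⊗ X : E(w) ⊗ H → E(w) ⊗ K`. -/
def wordMap {H K : HilbRep.{w, u} B} (X : HilbRep.Hom H K) :
    ∀ w : List (Fin k), HilbRep.Hom (𝔼.word w H) (𝔼.word w K)
  | [] => X
  | i :: w => (𝔼.E i).lTensor (wordMap X w)

/-- The unitary `E_i ⊗ (E(w) ⊗ E(w') ⊗ H) → E(w) ⊗ E_i ⊗ E(w') ⊗ H` which moves `E_i` through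
`E(w)` by means of the isomorphisms `t i j`. -/
def moveThrough (i : Fin k) (H : HilbRep.{w, u} B) (w' : List (Fin k)) :
    ∀ w : List (Fin k),
      HilbRep.Hom ((𝔼.E i).tensorRep (𝔼.word (w ++ w') H)) (𝔼.word (w ++ i :: w') H)
  | [] => HilbRep.Hom.id _
  | j :: w => ((𝔼.E j).lTensor (moveThrough i H w' w)).comp
      (CStarCorr.flip (𝔼.t i j) (𝔼.word (w ++ w') H))

/-- For a multi-index `n`, the unitary `E_i ⊗ E(n) ⊗ H → E(n + e_i) ⊗ H` given by the product
system. -/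
def shiftMap (i : Fin k) (n : Fin k → ℕ) (H : HilbRep.{w, u} B) :
    HilbRep.Hom ((𝔼.E i).tensorRep (𝔼.word (multiWord n) H))
      (𝔼.word (multiWord (n + Pi.single i 1)) H) :=
  (HilbRep.Hom.ofEq (by rw [multiWord_add])).comp
    ((𝔼.moveThrough i H ((multiWord n).dropWhile fun j => ¬ i ≤ j)
      ((multiWord n).takeWhile fun j => ¬ i ≤ j)).comp
        ((𝔼.E i).lTensor
          (HilbRep.Hom.ofEq (by rw [List.takeWhile_append_dropWhile]))))

lemma contraction_moveThrough (i : Fin k) (H : HilbRep.{w, u} B) (w' w : List (Fin k)) :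
    (𝔼.moveThrough i H w' w).Contraction := by
  induction w with
  | nil => exact fun x => le_rfl
  | cons j w ih => exact (CStarCorr.contraction_lTensor ih).comp (CStarCorr.contraction_flip _ _)

lemma contraction_shiftMap (i : Fin k) (n : Fin k → ℕ) (H : HilbRep.{w, u} B) :
    (𝔼.shiftMap i n H).Contraction :=
  (HilbRep.Hom.contraction_ofEq _).comp
    ((𝔼.contraction_moveThrough i H _ _).comp
      (CStarCorr.contraction_lTensor (HilbRep.Hom.contraction_ofEq _)))

/-- The Hilbert space `𝓕(𝔼) ⊗ H = ⊕ₙ E(n) ⊗ H`, where `𝓕(𝔼) = ⊕ₙ E(n)` is the Fock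
correspondence, with the representation `ρ(a) = φ_∞(a) ⊗ I_H`. -/
def fock (H : HilbRep.{w, u} B) : HilbRep.{w, u} B :=
  .dsum fun n : Fin k → ℕ => 𝔼.word (multiWord n) H

/-- The operators `S⁽ⁱ⁾(ξ) = T_ξ ⊗ I_H` on `𝓕(𝔼) ⊗ H`, where `T_ξ` is the creation operator
`η ↦ ξ ⊗ η`, which maps `E(n)` into `E(n + e_i)`. -/
def shift (i : Fin k) (H : HilbRep.{w, u} B) : 𝔼.E i →ₗ[ℂ] (𝔼.fock H →L[ℂ] 𝔼.fock H) :=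
  CStarCorr.sumShift (fun n => 𝔼.word (multiWord n) H) (fun n => n + Pi.single i 1)
    (add_left_injective _) (fun n => 𝔼.shiftMap i n H) fun n => 𝔼.contraction_shiftMap i n H

/-- The operator `S̃⁽ⁱ⁾ : E_i ⊗ (𝓕(𝔼) ⊗ H) → 𝓕(𝔼) ⊗ H` of the induced representation. -/
def shiftTilde (i : Fin k) (H : HilbRep.{w, u} B) :
    HilbRep.Hom ((𝔼.E i).tensorRep (𝔼.fock H)) (𝔼.fock H) :=
  CStarCorr.liftHom (𝔼.shift i H) (CStarCorr.sumShift_tensorBounded _ _ _ _ _)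
    (CStarCorr.sumShift_lact _ _ _ _ _)

/-! ### Completely contractive covariant representations of a product system -/

/-- A completely contractive covariant representation `(σ, V⁽¹⁾, …, V⁽ᵏ⁾)` of `𝔼`, where `σ` is
the representation of `B` on the Hilbert space of `H`:
`Ṽ⁽ⁱ⁾(I_{E_i} ⊗ Ṽ⁽ʲ⁾) = Ṽ⁽ʲ⁾(I_{E_j} ⊗ Ṽ⁽ⁱ⁾)(t i j ⊗ I_H)`. -/
structure CCRep (H : HilbRep.{w, u} B) where
  V : ∀ i, (𝔼.E i).CCRep H
  comm : ∀ i j, (V i).tilde.comp ((𝔼.E i).lTensor (V j).tilde)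
    = ((V j).tilde.comp ((𝔼.E j).lTensor (V i).tilde)).comp (CStarCorr.flip (𝔼.t i j) H)

namespace CCRep

variable {𝔼} {H : HilbRep.{w, u} B} (V : 𝔼.CCRep H)

/-- The operator `Ṽ_w : E(w) ⊗ H → H`,
`Ṽ_w = Ṽ⁽ⁱ¹⁾(I ⊗ Ṽ⁽ⁱ²⁾)(I ⊗ I ⊗ Ṽ⁽ⁱ³⁾) ⋯` for `w = i₁ i₂ i₃ ⋯`. -/
def tildeWord : ∀ w : List (Fin k), HilbRep.Hom (𝔼.word w H) H
  | [] => HilbRep.Hom.id H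
  | i :: w => (V.V i).tilde.comp ((𝔼.E i).lTensor (tildeWord w))

/-- The operator `Ṽ_n : E(n) ⊗ H → H` for a multi-index `n`. -/
def tilde (n : Fin k → ℕ) : HilbRep.Hom (𝔼.word (multiWord n) H) H := V.tildeWord (multiWord n)

end CCRep

/-- The space `E(n)^{⊗p} ⊗ H`. -/
def powSpace (n : Fin k → ℕ) (H : HilbRep.{w, u} B) : ℕ → HilbRep.{w, u} B
  | 0 => H
  | p + 1 => 𝔼.word (multiWord n) (powSpace n H p)

namespace CCRep

variable {𝔼} {H : HilbRep.{w, u} B} (V : 𝔼.CCRep H)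

/-- The generalized power `Ṽ_n^p : E(n)^{⊗p} ⊗ H → H`,
`Ṽ_n^p = Ṽ_n(I ⊗ Ṽ_n)(I ⊗ I ⊗ Ṽ_n) ⋯` with `p` factors. -/
def tildePow (n : Fin k → ℕ) : ∀ p : ℕ, HilbRep.Hom (𝔼.powSpace n H p) H
  | 0 => HilbRep.Hom.id H
  | p + 1 => (V.tilde n).comp (𝔼.wordMap (tildePow n p) (multiWord n))

end CCRep

/-- The multi-index `e(u)`, the indicator function of the set `u`. -/
def indicator (u : Finset (Fin k)) : Fin k → ℕ := fun i => if i ∈ u then 1 else 0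

namespace CCRep

variable {𝔼} {H : HilbRep.{w, u} B} (V : 𝔼.CCRep H)

/-- The operator `∑_u (-1)^{|u|} Ṽ_{e(u)} Ṽ_{e(u)}⋆` on `H`. -/
def defectSq : H →L[ℂ] H :=
  ∑ u : Finset (Fin k), (-1 : ℂ) ^ u.card •
    ((V.tilde (indicator u)).toCLM ∘L ContinuousLinearMap.adjoint (V.tilde (indicator u)).toCLM)

/-- The Brehmer–Solel condition `∑_u (-1)^{|u|} Ṽ_{e(u)} Ṽ_{e(u)}⋆ ≥ 0`. -/
def IsBrehmerSolel : Prop := 0 ≤ V.defectSq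

lemma commute_defectSq (a : B) : Commute V.defectSq (H.rep a) := by
  refine Commute.sum_left _ _ _ fun u _ => Commute.smul_left ?_ _
  refine ContinuousLinearMap.ext fun x => ?_
  exact ((V.tilde (indicator u)).comp (V.tilde (indicator u)).adjoint).comm a x

/-- The defect operator `Δ⋆(V) = (∑_u (-1)^{|u|} Ṽ_{e(u)} Ṽ_{e(u)}⋆)^{1/2}`. -/
def defectOp : H →L[ℂ] H := CFC.sqrt V.defectSq

lemma defectOp_comm (a : B) (x : H) : V.defectOp (H.rep a x) = H.rep a (V.defectOp x) :=
  congrArg (fun f : H →L[ℂ] H => f x) ((V.commute_defectSq a).cfcₙ_nnreal NNReal.sqrt).eq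

/-- The defect space `𝓓⋆`, the closure of the range of `Δ⋆(V)`, with the restriction of `σ`. -/
def defectRep : HilbRep.{w, u} B :=
  H.sub (LinearMap.range (V.defectOp : H →ₗ[ℂ] H)).topologicalClosure
    (Submodule.isClosed_topologicalClosure _) fun a x hx => by
      refine map_mem_closure (H.rep a).continuous hx ?_
      rintro _ ⟨y, rfl⟩
      exact ⟨H.rep a y, V.defectOp_comm a y⟩

/-- The operator `Δ⋆(V)` as an operator from `H` to `𝓓⋆`. -/
def defectHom : HilbRep.Hom H V.defectRep where
  toCLM := V.defectOp.codRestrict (LinearMap.range (V.defectOp : H →ₗ[ℂ] H)).topologicalClosure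
    fun x => subset_closure ⟨x, rfl⟩
  comm a x := Subtype.ext (V.defectOp_comm a x)

end CCRep

end ProductSystem

end BrehmerSolel

end

/-!
The Poisson kernel `Π_V` of a representation of a product system satisfying the Brehmer–Solel
condition.

Fix `h` and put `a(n) = ‖Ṽ_n⋆ h‖²`. The numbers `‖Ṽ_w⋆ h‖` for words `w` depend only on how often
each letter occurs in `w` (`norm_tildeWord_adjoint_perm`): exchanging adjacent letters composes
`Ṽ_w` with a contractive flip, and this can be done in both directions. In particular
`‖Ṽ_{e(u)}^{*p} h‖² = a(p e(u))` (`norm_tildePow_adjoint`).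

By definition of the defect operator `‖Δ⋆(V) h‖² = ∑_u (-1)^{|u|} a(e(u))`. Such a quadratic identity
survives amplification by `I_{E(n)}` (`norm_sq_lTensor`, `norm_sq_wordMap`), because the norm of
`E ⊗ H` is computed from the Gram matrix of vectors of `E`. Applied to `Ṽ_n⋆ h` it gives
`‖(I ⊗ Δ⋆(V)) Ṽ_n⋆ h‖² = ∑_u (-1)^{|u|} a(n + e(u))`. Summed over the box `[0, p)ᵏ` this telescopes to
`∑_u (-1)^{|u|} a(p e(u))` (`sum_box_alternating`), which is at most `2ᵏ ‖h‖²` because the `Ṽ_n` are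
contractions. So the coordinates of `Π_V h` are square summable, `Π_V` is bounded, and `‖Π_V h‖²` is
the limit of the box sums.

The intertwining relation with `S̃⁽ⁱ⁾` is proved in its adjoint form (`poisson_adjoint_shiftTilde`).
On `E_i ⊗ E(n) ⊗ 𝓓⋆` it says that `Ṽ_{n + e_i}` composed with the identification of `E_i ⊗ E(n)` with
`E(n + e_i)` is `Ṽ⁽ⁱ⁾(I ⊗ Ṽ_n)` (`tilde_comp_shiftMap`), together with the naturality of this
identification (`shiftMap_natural`).
-/

namespace BrehmerSolel

/-! ### Telescoping sums over boxes -/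

/-- The alternating sum over a unit cube, summed over the box `[0, p)ᵏ`, telescopes: this is
`∏ᵢ (1 + Xᵢ + ⋯ + Xᵢᵖ⁻¹)(1 - Xᵢ) = ∏ᵢ (1 - Xᵢᵖ)`, read through the linear functional on polynomials
which sends the monomial `Xⁿ` to `a n`. -/
lemma sum_box_alternating {k : ℕ} (a : (Fin k → ℕ) → ℝ) (p : ℕ) :
    ∑ n ∈ Fintype.piFinset fun _ : Fin k => Finset.range p,
        ∑ u : Finset (Fin k), (-1 : ℝ) ^ u.card * a (n + ProductSystem.indicator u)
      = ∑ u : Finset (Fin k), (-1 : ℝ) ^ u.card * a (p • ProductSystem.indicator u) := by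
  let x : Fin k → MvPolynomial (Fin k) ℝ := MvPolynomial.X
  let L : MvPolynomial (Fin k) ℝ →ₗ[ℝ] ℝ :=
    (MvPolynomial.basisMonomials (Fin k) ℝ).constr ℝ fun m => a m
  have hL : ∀ n : Fin k → ℕ, L (∏ i, x i ^ n i) = a n := fun n => by
    have h := (MvPolynomial.basisMonomials (Fin k) ℝ).constr_basis ℝ (fun m => a m)
      (Finsupp.equivFunOnFinite.symm n)
    rw [MvPolynomial.coe_basisMonomials] at h
    have e : ∏ i, x i ^ n i
        = MvPolynomial.monomial (Finsupp.equivFunOnFinite.symm n) (1 : ℝ) := by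
      rw [MvPolynomial.monomial_eq, map_one, one_mul, Finsupp.prod_fintype _ _ (by simp)]
      rfl
    rw [e]
    exact h
  have hind : ∀ (u : Finset (Fin k)) (m : ℕ),
      ∏ i ∈ u, x i ^ m = ∏ i, x i ^ (m • ProductSystem.indicator u) i := fun u m => by
    simp [ProductSystem.indicator, Finset.prod_ite_mem]
  have hsub : ∀ m : ℕ, ∏ i, (1 - x i ^ m)
      = ∑ u : Finset (Fin k), (-1 : ℝ) ^ u.card •
        ∏ i, x i ^ (m • ProductSystem.indicator u) i := fun m => by
    rw [Finset.prod_sub, Finset.powerset_univ]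
    refine Finset.sum_congr rfl fun u _ => ?_
    rw [Finset.prod_const_one, mul_one, hind, MvPolynomial.smul_eq_C_mul]
    simp
  have h1 : ∏ i, (1 - x i ^ p)
      = ∑ n ∈ Fintype.piFinset fun _ : Fin k => Finset.range p,
        ∑ u : Finset (Fin k), (-1 : ℝ) ^ u.card •
          ∏ i, x i ^ (n + ProductSystem.indicator u) i := by
    calc ∏ i, (1 - x i ^ p)
        = (∏ i, ∑ j ∈ Finset.range p, x i ^ j) * ∏ i, (1 - x i ^ 1) := by
          rw [← Finset.prod_mul_distrib]
          simp only [pow_one, geom_sum_mul_neg]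
      _ = _ := by
          rw [Finset.prod_univ_sum, hsub, Finset.sum_mul]
          refine Finset.sum_congr rfl fun n _ => ?_
          rw [Finset.mul_sum]
          refine Finset.sum_congr rfl fun u _ => ?_
          rw [mul_smul_comm, ← Finset.prod_mul_distrib]
          simp only [one_smul, Pi.add_apply, pow_add]
  have h2 := congrArg L (h1.symm.trans (hsub p))
  simpa only [map_sum, map_smul, smul_eq_mul, hL] using h2

/-- The boxes `[0, p)ᵏ` exhaust `ℕᵏ`. -/
lemma tendsto_box (k : ℕ) :
    Tendsto (fun p : ℕ => Fintype.piFinset fun _ : Fin k => Finset.range p) atTop atTop := by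
  refine tendsto_atTop_finset_of_monotone (fun p q hpq => ?_) fun n => ?_
  · exact Fintype.piFinset_subset _ _ fun _ => Finset.range_mono hpq
  · refine ⟨Finset.univ.sup n + 1, Fintype.mem_piFinset.mpr fun i => ?_⟩
    exact Finset.mem_range.mpr (Nat.lt_succ_of_le (Finset.le_sup (f := n) (Finset.mem_univ i)))

/-- A nonnegative family on `ℕᵏ` whose sums over boxes are bounded is summable. -/
lemma summable_of_sum_box_le {k : ℕ} {f : (Fin k → ℕ) → ℝ} {C : ℝ} (hf : ∀ n, 0 ≤ f n)
    (hC : ∀ p : ℕ, ∑ n ∈ Fintype.piFinset fun _ : Fin k => Finset.range p, f n ≤ C) :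
    Summable f := by
  refine summable_of_sum_le (c := C) hf fun s => ?_
  obtain ⟨p, hp⟩ := ((tendsto_box k).eventually_ge_atTop s).exists
  exact (Finset.sum_le_sum_of_subset_of_nonneg hp fun n _ _ => hf n).trans (hC p)

/-! ### The functor `E ⊗ ·` on representations -/

namespace HilbRep.Hom

variable {B : Type w} [NonUnitalCStarAlgebra B] {H K L : HilbRep.{w, u} B}

lemma adjoint_comp (Y : Hom K L) (X : Hom H K) :
    (Y.comp X).adjoint = X.adjoint.comp Y.adjoint :=
  Hom.ext fun x => congrArg (fun f => f x) (ContinuousLinearMap.adjoint_comp Y.toCLM X.toCLM)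

@[simp] lemma adjoint_adjoint (X : Hom H K) : X.adjoint.adjoint = X :=
  Hom.ext fun x => congrArg (fun f => f x) (ContinuousLinearMap.adjoint_adjoint X.toCLM)

lemma adjoint_id : (Hom.id H).adjoint = Hom.id H :=
  Hom.ext fun x => by
    change ContinuousLinearMap.adjoint (ContinuousLinearMap.id ℂ H) x = x
    rw [ContinuousLinearMap.adjoint_id]
    rfl

lemma adjoint_inner_left (X : Hom H K) (x : H) (y : K) :
    inner ℂ (X.adjoint y) x = inner ℂ y (X x) :=
  ContinuousLinearMap.adjoint_inner_left X.toCLM x y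

lemma comp_assoc {M : HilbRep.{w, u} B} (Z : Hom L M) (Y : Hom K L) (X : Hom H K) :
    (Z.comp Y).comp X = Z.comp (Y.comp X) := rfl

end HilbRep.Hom

variable {B : Type w} [NonUnitalCStarAlgebra B] [PartialOrder B] [StarOrderedRing B]

namespace CStarCorr

variable {E F : CStarCorr.{w, u} B} {H K L : HilbRep.{w, u} B}

lemma hom_ext {X Y : HilbRep.Hom (E.tensorRep H) K}
    (h : ∀ x y, X (E.tmulRep H x y) = Y (E.tmulRep H x y)) : X = Y :=
  HilbRep.Hom.ext fun z =>
    congrArg (fun f => f z) (E.tensorRep_ext H (f := X.toCLM) (g := Y.toCLM) h)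

lemma hom_ext₂ {X Y : HilbRep.Hom (E.tensorRep (F.tensorRep H)) K}
    (h : ∀ x y z, X (E.tmulRep _ x (F.tmulRep H y z)) = Y (E.tmulRep _ x (F.tmulRep H y z))) :
    X = Y :=
  hom_ext fun x y => congrArg (fun f => f y) (F.tensorRep_ext H
    (f := X.toCLM ∘L E.creation _ x) (g := Y.toCLM ∘L E.creation _ x) (h x))

lemma lTensor_comp (Y : HilbRep.Hom K L) (X : HilbRep.Hom H K) :
    E.lTensor (Y.comp X) = (E.lTensor Y).comp (E.lTensor X) :=
  hom_ext fun x h => by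
    change _ = E.lTensor Y (E.lTensor X (E.tmulRep H x h))
    rw [lTensor_tmulRep, lTensor_tmulRep, lTensor_tmulRep]
    rfl

lemma lTensor_adjoint (X : HilbRep.Hom H K) : E.lTensor X.adjoint = (E.lTensor X).adjoint :=
  hom_ext fun x k => by
    refine ext_inner_right ℂ fun z => ?_
    refine congrArg (fun f : E.tensorRep H →L[ℂ] ℂ => f z) (E.tensorRep_ext H
      (f := innerSL ℂ (E.lTensor X.adjoint (E.tmulRep K x k)))
      (g := innerSL ℂ ((E.lTensor X).adjoint (E.tmulRep K x k))) fun y h => ?_)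
    rw [innerSL_apply_apply, innerSL_apply_apply, HilbRep.Hom.adjoint_inner_left,
      lTensor_tmulRep, lTensor_tmulRep, inner_tmulRep, inner_tmulRep,
      HilbRep.Hom.adjoint_inner_left, X.comm]

/-- A quadratic identity `‖Dh‖² = ∑ⱼ cⱼ ‖Xⱼh‖²` between intertwining operators persists after
tensoring with `I_E`, because the norm of `E ⊗ H` is a sum of squares of norms in `H` with the same
coefficients from `B` for every `H`. -/
lemma norm_sq_lTensor {ι : Type*} (s : Finset ι) (c : ι → ℝ) {G : ι → HilbRep.{w, u} B}
    (X : ∀ j, HilbRep.Hom H (G j)) (D : HilbRep.Hom H K)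
    (hD : ∀ h, ‖D h‖ ^ 2 = ∑ j ∈ s, c j * ‖X j h‖ ^ 2) (z : E.tensorRep H) :
    ‖E.lTensor D z‖ ^ 2 = ∑ j ∈ s, c j * ‖E.lTensor (X j) z‖ ^ 2 := by
  -- With `⟨xᵢ, xⱼ⟩ = ∑ₗ bₗᵢ⋆ bₗⱼ`, both sides become sums over `l` of the hypothesis at the vectors
  -- `∑ᵢ σ(bₗᵢ) hᵢ`, since the operators intertwine the representations.
  have halg : ∀ {K : HilbRep.{w, u} B} (Y : HilbRep.Hom H K) {n : ℕ} (x : Fin n → E)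
      (h : Fin n → H) (b : Fin n → Fin n → B),
      (∀ i j, E.ip (x i) (x j) = ∑ l, star (b l i) * b l j) →
      ‖(E.lTensor Y).toCLM (E.ofAlg H (∑ i, x i ⊗ₜ[ℂ] h i))‖ ^ 2
        = ∑ l, ‖Y.toCLM (∑ i, H.rep (b l i) (h i))‖ ^ 2 := by
    intro K Y n x h b hb
    have e : (E.lTensor Y).toCLM (E.ofAlg H (∑ i, x i ⊗ₜ[ℂ] h i))
        = E.ofAlg K (∑ i, x i ⊗ₜ[ℂ] Y.toCLM (h i)) := by
      simp only [map_sum]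
      exact Finset.sum_congr rfl fun i _ => lTensor_tmulRep E Y (x i) (h i)
    rw [e, norm_sq_of_gram E K x _ b hb]
    refine Finset.sum_congr rfl fun l _ => ?_
    rw [map_sum]
    simp only [Y.comm]
  refine DenseRange.induction_on
    (p := fun z => ‖(E.lTensor D).toCLM z‖ ^ 2 = ∑ j ∈ s, c j * ‖(E.lTensor (X j)).toCLM z‖ ^ 2)
    (E.denseRange_ofAlg H) z (isClosed_eq (by fun_prop) (by fun_prop)) fun z => ?_
  obtain ⟨n, x, h, rfl⟩ := PreCorr.exists_fin_sum z
  obtain ⟨b, hb⟩ := E.toPre.exists_gram x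
  simp only [halg _ x h b hb, hD, Finset.mul_sum]
  exact Finset.sum_comm

lemma norm_lTensor_congr {X : HilbRep.Hom H K} {Y : HilbRep.Hom H L}
    (hXY : ∀ h, ‖X h‖ = ‖Y h‖) (z : E.tensorRep H) : ‖E.lTensor X z‖ = ‖E.lTensor Y z‖ := by
  have := norm_sq_lTensor (E := E) {()} (fun _ => 1) (G := fun _ => L) (fun _ => Y) X
    (fun h => by simp [hXY]) z
  rw [Finset.sum_singleton, one_mul] at this
  exact (sq_eq_sq₀ (norm_nonneg _) (norm_nonneg _)).mp this

/-! ### Naturality of the flip unitaries -/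

lemma assoc_natural (X : HilbRep.Hom H K) :
    (E.assoc F K).comp (E.lTensor (F.lTensor X))
      = ((E.tensor F).lTensor X).comp (E.assoc F H) :=
  hom_ext₂ fun x y h => by
    change E.assoc F K (E.lTensor (F.lTensor X) (E.tmulRep _ x (F.tmulRep H y h)))
      = (E.tensor F).lTensor X (E.assoc F H (E.tmulRep _ x (F.tmulRep H y h)))
    rw [lTensor_tmulRep, lTensor_tmulRep, assoc_tmul, assoc_tmul, lTensor_tmulRep]

/-- The adjoint of `assoc_natural` for `X⋆`. -/
lemma assoc_adjoint_natural (X : HilbRep.Hom H K) :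
    (E.assoc F K).adjoint.comp ((E.tensor F).lTensor X)
      = (E.lTensor (F.lTensor X)).comp (E.assoc F H).adjoint := by
  have h := congrArg HilbRep.Hom.adjoint (assoc_natural (E := E) (F := F) X.adjoint)
  simp only [HilbRep.Hom.adjoint_comp, lTensor_adjoint, HilbRep.Hom.adjoint_adjoint] at h
  exact h.symm

lemma rTensor_natural (t : E.Iso F) (X : HilbRep.Hom H K) :
    (rTensor t K).comp (E.lTensor X) = (F.lTensor X).comp (rTensor t H) :=
  hom_ext fun x h => by
    change rTensor t K (E.lTensor X (E.tmulRep H x h)) = F.lTensor X (rTensor t H (E.tmulRep H x h))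
    rw [lTensor_tmulRep, rTensor_tmulRep, rTensor_tmulRep, lTensor_tmulRep]

lemma flip_natural (t : (E.tensor F).Iso (F.tensor E)) (X : HilbRep.Hom H K) :
    (flip t K).comp (E.lTensor (F.lTensor X)) = (F.lTensor (E.lTensor X)).comp (flip t H) := by
  unfold flip
  rw [HilbRep.Hom.comp_assoc, HilbRep.Hom.comp_assoc, assoc_natural,
    ← HilbRep.Hom.comp_assoc _ _ (E.assoc F H), rTensor_natural, HilbRep.Hom.comp_assoc,
    ← HilbRep.Hom.comp_assoc, assoc_adjoint_natural]
  rfl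

end CStarCorr

namespace ProductSystem

variable {k : ℕ} {𝔼 : ProductSystem.{w, u} B k}

/-- The version of `CStarCorr.norm_sq_lTensor` for the amplifications `I_{E(w)} ⊗ X`. -/
lemma norm_sq_wordMap {H K : HilbRep.{w, u} B} {ι : Type*} (s : Finset ι) (c : ι → ℝ)
    {G : ι → HilbRep.{w, u} B} (X : ∀ j, HilbRep.Hom H (G j)) (D : HilbRep.Hom H K)
    (hD : ∀ h, ‖D h‖ ^ 2 = ∑ j ∈ s, c j * ‖X j h‖ ^ 2) (v : List (Fin k)) (z : 𝔼.word v H) :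
    ‖𝔼.wordMap D v z‖ ^ 2 = ∑ j ∈ s, c j * ‖𝔼.wordMap (X j) v z‖ ^ 2 := by
  induction v with
  | nil => exact hD z
  | cons i v ih => exact CStarCorr.norm_sq_lTensor s c (fun j => 𝔼.wordMap (X j) v) _ ih z

lemma norm_wordMap_congr {H K L : HilbRep.{w, u} B} {X : HilbRep.Hom H K} {Y : HilbRep.Hom H L}
    (hXY : ∀ h, ‖X h‖ = ‖Y h‖) (v : List (Fin k)) (z : 𝔼.word v H) :
    ‖𝔼.wordMap X v z‖ = ‖𝔼.wordMap Y v z‖ := by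
  induction v with
  | nil => exact hXY z
  | cons i v ih => exact CStarCorr.norm_lTensor_congr ih z

lemma wordMap_adjoint {H K : HilbRep.{w, u} B} (X : HilbRep.Hom H K) (v : List (Fin k)) :
    𝔼.wordMap X.adjoint v = (𝔼.wordMap X v).adjoint := by
  induction v with
  | nil => rfl
  | cons i v ih => exact (congrArg _ ih).trans (CStarCorr.lTensor_adjoint _)

/-- The operators `I ⊗ X` commute with moving a factor `E_i` through a word. -/
lemma moveThrough_natural {H K : HilbRep.{w, u} B} (X : HilbRep.Hom H K) (i : Fin k)
    (v' v : List (Fin k)) :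
    (𝔼.moveThrough i K v' v).comp ((𝔼.E i).lTensor (𝔼.wordMap X (v ++ v')))
      = (𝔼.wordMap X (v ++ i :: v')).comp (𝔼.moveThrough i H v' v) := by
  induction v with
  | nil => rfl
  | cons j v ih =>
    change (((𝔼.E j).lTensor (𝔼.moveThrough i K v' v)).comp
        (CStarCorr.flip (𝔼.t i j) (𝔼.word (v ++ v') K))).comp
        ((𝔼.E i).lTensor ((𝔼.E j).lTensor (𝔼.wordMap X (v ++ v'))))
      = ((𝔼.E j).lTensor (𝔼.wordMap X (v ++ i :: v'))).comp
        (((𝔼.E j).lTensor (𝔼.moveThrough i H v' v)).comp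
          (CStarCorr.flip (𝔼.t i j) (𝔼.word (v ++ v') H)))
    rw [HilbRep.Hom.comp_assoc, CStarCorr.flip_natural, ← HilbRep.Hom.comp_assoc,
      ← CStarCorr.lTensor_comp, ih, CStarCorr.lTensor_comp]
    rfl

lemma wordMap_comp_ofEq {H K : HilbRep.{w, u} B} (X : HilbRep.Hom H K) {v v' : List (Fin k)}
    (h : v = v') :
    (𝔼.wordMap X v').comp (HilbRep.Hom.ofEq (congrArg (𝔼.word · H) h))
      = (HilbRep.Hom.ofEq (congrArg (𝔼.word · K) h)).comp (𝔼.wordMap X v) := by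
  subst h
  rfl

lemma shiftMap_natural {H K : HilbRep.{w, u} B} (X : HilbRep.Hom H K) (i : Fin k)
    (n : Fin k → ℕ) :
    (𝔼.shiftMap i n K).comp ((𝔼.E i).lTensor (𝔼.wordMap X (multiWord n)))
      = (𝔼.wordMap X (multiWord (n + Pi.single i 1))).comp (𝔼.shiftMap i n H) := by
  unfold shiftMap
  rw [← HilbRep.Hom.comp_assoc (𝔼.wordMap X _), wordMap_comp_ofEq X (multiWord_add n i).symm,
    HilbRep.Hom.comp_assoc, HilbRep.Hom.comp_assoc, HilbRep.Hom.comp_assoc,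
    ← CStarCorr.lTensor_comp,
    ← wordMap_comp_ofEq X (List.takeWhile_append_dropWhile (p := fun j => ¬ i ≤ j)).symm,
    CStarCorr.lTensor_comp, ← HilbRep.Hom.comp_assoc (𝔼.moveThrough i K _ _),
    moveThrough_natural]
  rfl

namespace CCRep

variable {H : HilbRep.{w, u} B} (V : 𝔼.CCRep H)

/-! ### The operators `Ṽ_w` -/

lemma contraction_tildeWord (v : List (Fin k)) : (V.tildeWord v).Contraction := by
  induction v with
  | nil => exact fun x => le_rfl
  | cons i v ih =>
    exact (CStarCorr.contraction_liftHom _ _ _).comp (CStarCorr.contraction_lTensor ih)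

lemma tildeWord_cons_adjoint (i : Fin k) (v : List (Fin k)) (h : H) :
    (V.tildeWord (i :: v)).adjoint h
      = (𝔼.E i).lTensor (V.tildeWord v).adjoint ((V.V i).tilde.adjoint h) := by
  rw [CStarCorr.lTensor_adjoint]
  exact congrArg (fun X : HilbRep.Hom _ _ => X h)
    (HilbRep.Hom.adjoint_comp (V.V i).tilde ((𝔼.E i).lTensor (V.tildeWord v)))

/-- Two adjacent letters of a word can be interchanged, up to a flip unitary. -/
lemma tildeWord_swap (i j : Fin k) (v : List (Fin k)) :
    V.tildeWord (i :: j :: v)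
      = (V.tildeWord (j :: i :: v)).comp (CStarCorr.flip (𝔼.t i j) (𝔼.word v H)) := by
  change (V.V i).tilde.comp ((𝔼.E i).lTensor ((V.V j).tilde.comp
      ((𝔼.E j).lTensor (V.tildeWord v))))
    = ((V.V j).tilde.comp ((𝔼.E j).lTensor ((V.V i).tilde.comp
      ((𝔼.E i).lTensor (V.tildeWord v))))).comp (CStarCorr.flip (𝔼.t i j) (𝔼.word v H))
  simp only [CStarCorr.lTensor_comp]
  rw [← HilbRep.Hom.comp_assoc, V.comm i j, HilbRep.Hom.comp_assoc, CStarCorr.flip_natural]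
  rfl

/-- The norm of `Ṽ_w⋆ h` depends only on the number of times each letter occurs in `w`. -/
lemma norm_tildeWord_adjoint_perm {v v' : List (Fin k)} (hv : v.Perm v') (h : H) :
    ‖(V.tildeWord v).adjoint h‖ = ‖(V.tildeWord v').adjoint h‖ := by
  induction hv generalizing h with
  | nil => rfl
  | cons i _ ih =>
    rw [tildeWord_cons_adjoint, tildeWord_cons_adjoint]
    exact CStarCorr.norm_lTensor_congr ih _
  | swap i j v =>
    -- The flips are contractive, so the two words dominate each other.
    have key : ∀ i j, ‖(V.tildeWord (i :: j :: v)).adjoint h‖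
        ≤ ‖(V.tildeWord (j :: i :: v)).adjoint h‖ := fun i j => by
      rw [tildeWord_swap]
      exact (congrArg (fun X : HilbRep.Hom _ _ => ‖X h‖) (HilbRep.Hom.adjoint_comp
        (V.tildeWord (j :: i :: v)) (CStarCorr.flip (𝔼.t i j) (𝔼.word v H)))).trans_le
          ((CStarCorr.contraction_flip _ _).adjoint _)
    exact le_antisymm (key _ _) (key _ _)
  | trans _ _ ih₁ ih₂ => exact (ih₁ h).trans (ih₂ h)

/-- Up to a unitary, `Ṽ_{vv'}⋆ = (I_{E(v)} ⊗ Ṽ_{v'}⋆) Ṽ_v⋆`. -/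
lemma norm_wordMap_tildeWord_adjoint (v v' : List (Fin k)) (h : H) :
    ‖𝔼.wordMap (V.tildeWord v').adjoint v ((V.tildeWord v).adjoint h)‖
      = ‖(V.tildeWord (v ++ v')).adjoint h‖ := by
  induction v generalizing h with
  | nil =>
    change ‖(V.tildeWord v').adjoint ((HilbRep.Hom.id H).adjoint h)‖ = _
    rw [HilbRep.Hom.adjoint_id]
    rfl
  | cons i v ih =>
    rw [List.cons_append, tildeWord_cons_adjoint, tildeWord_cons_adjoint]
    refine Eq.trans ?_ (CStarCorr.norm_lTensor_congr
      (X := (𝔼.wordMap (V.tildeWord v').adjoint v).comp (V.tildeWord v).adjoint) ih _)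
    rw [CStarCorr.lTensor_comp]
    rfl

lemma multiWord_append_perm (n m : Fin k → ℕ) :
    (multiWord n ++ multiWord m).Perm (multiWord (n + m)) := by
  rw [List.perm_iff_count]
  intro i
  simp [count_multiWord]

lemma norm_wordMap_tilde_adjoint (n m : Fin k → ℕ) (h : H) :
    ‖𝔼.wordMap (V.tilde m).adjoint (multiWord n) ((V.tilde n).adjoint h)‖
      = ‖(V.tilde (n + m)).adjoint h‖ :=
  (V.norm_wordMap_tildeWord_adjoint _ _ h).trans
    (V.norm_tildeWord_adjoint_perm (multiWord_append_perm n m) h)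

lemma norm_tilde_zero_adjoint (h : H) : ‖(V.tilde 0).adjoint h‖ = ‖h‖ := by
  have h0 : multiWord (0 : Fin k → ℕ) = [] := by simp [multiWord]
  rw [tilde, h0]
  change ‖(HilbRep.Hom.id H).adjoint h‖ = ‖h‖
  rw [HilbRep.Hom.adjoint_id]
  rfl

/-- The `p`-th generalized power of `Ṽ_n` agrees with `Ṽ_{pn}` as far as norms are concerned, since
the underlying words are permutations of each other. -/
lemma norm_tildePow_adjoint (n : Fin k → ℕ) (p : ℕ) (h : H) :
    ‖(V.tildePow n p).adjoint h‖ = ‖(V.tilde (p • n)).adjoint h‖ := by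
  induction p generalizing h with
  | zero =>
    rw [zero_smul, norm_tilde_zero_adjoint]
    change ‖(HilbRep.Hom.id H).adjoint h‖ = ‖h‖
    rw [HilbRep.Hom.adjoint_id]
    rfl
  | succ p ih =>
    rw [succ_nsmul', ← norm_wordMap_tilde_adjoint]
    change ‖((V.tilde n).comp (𝔼.wordMap (V.tildePow n p) (multiWord n))).adjoint h‖ = _
    rw [HilbRep.Hom.adjoint_comp, ← wordMap_adjoint]
    exact norm_wordMap_congr ih _ _

/-- Moving a factor `E_i` through a word turns `Ṽ⁽ⁱ⁾(I ⊗ Ṽ_w)` into the operator of the longer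
word. -/
lemma tildeWord_comp_moveThrough (i : Fin k) (v' v : List (Fin k)) :
    (V.tildeWord (v ++ i :: v')).comp (𝔼.moveThrough i H v' v)
      = (V.V i).tilde.comp ((𝔼.E i).lTensor (V.tildeWord (v ++ v'))) := by
  induction v with
  | nil => rfl
  | cons j v ih =>
    change ((V.V j).tilde.comp ((𝔼.E j).lTensor (V.tildeWord (v ++ i :: v')))).comp
        (((𝔼.E j).lTensor (𝔼.moveThrough i H v' v)).comp
          (CStarCorr.flip (𝔼.t i j) (𝔼.word (v ++ v') H)))
      = V.tildeWord (i :: j :: (v ++ v'))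
    rw [tildeWord_swap, HilbRep.Hom.comp_assoc, ← HilbRep.Hom.comp_assoc ((𝔼.E j).lTensor _),
      ← CStarCorr.lTensor_comp, ih]
    rfl

lemma tildeWord_comp_ofEq {v v' : List (Fin k)} (h : v = v') :
    (V.tildeWord v').comp (HilbRep.Hom.ofEq (congrArg (𝔼.word · H) h)) = V.tildeWord v := by
  subst h
  rfl

lemma tilde_comp_shiftMap (i : Fin k) (n : Fin k → ℕ) :
    (V.tilde (n + Pi.single i 1)).comp (𝔼.shiftMap i n H)
      = (V.V i).tilde.comp ((𝔼.E i).lTensor (V.tilde n)) := by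
  unfold shiftMap tilde
  rw [← HilbRep.Hom.comp_assoc, V.tildeWord_comp_ofEq (multiWord_add n i).symm,
    ← HilbRep.Hom.comp_assoc, tildeWord_comp_moveThrough, HilbRep.Hom.comp_assoc,
    ← CStarCorr.lTensor_comp,
    V.tildeWord_comp_ofEq (List.takeWhile_append_dropWhile (p := fun j => ¬ i ≤ j)).symm]

/-! ### The defect operator and the Poisson kernel -/

lemma norm_sq_defectHom (hV : V.IsBrehmerSolel) (h : H) :
    ‖V.defectHom h‖ ^ 2
      = ∑ u : Finset (Fin k), (-1 : ℝ) ^ u.card * ‖(V.tilde (indicator u)).adjoint h‖ ^ 2 := by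
  have hsa : ContinuousLinearMap.adjoint V.defectOp = V.defectOp :=
    (IsSelfAdjoint.of_nonneg (CFC.sqrt_nonneg V.defectSq)).adjoint_eq
  have hsq : V.defectOp (V.defectOp h) = V.defectSq h :=
    congrArg (fun f : H →L[ℂ] H => f h) (CFC.sqrt_mul_sqrt_self V.defectSq hV)
  have h1 : ((‖V.defectHom h‖ ^ 2 : ℝ) : ℂ) = inner ℂ h (V.defectSq h) := by
    change ((‖V.defectOp h‖ ^ 2 : ℝ) : ℂ) = _
    rw [← hsq, ← ContinuousLinearMap.adjoint_inner_left, hsa, inner_self_eq_norm_sq_to_K]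
    norm_cast
  rw [← Complex.ofReal_inj, h1, defectSq, sum_apply, inner_sum, Complex.ofReal_sum]
  refine Finset.sum_congr rfl fun u _ => ?_
  rw [smul_apply, inner_smul_right, ContinuousLinearMap.comp_apply,
    ← ContinuousLinearMap.adjoint_inner_left, inner_self_eq_norm_sq_to_K]
  push_cast
  rfl

/-- The operator `(I_{E(n)} ⊗ Δ⋆(V)) Ṽ_n⋆`. -/
noncomputable def poissonCoord (n : Fin k → ℕ) : HilbRep.Hom H (𝔼.word (multiWord n) V.defectRep) :=
  (𝔼.wordMap V.defectHom (multiWord n)).comp (V.tilde n).adjoint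

/-- Passing from `h` to `Ṽ_n⋆ h` in the formula for `‖Δ⋆(V)h‖²` shifts all exponents by `n`. -/
lemma norm_sq_poissonCoord (hV : V.IsBrehmerSolel) (n : Fin k → ℕ) (h : H) :
    ‖V.poissonCoord n h‖ ^ 2
      = ∑ u : Finset (Fin k), (-1 : ℝ) ^ u.card * ‖(V.tilde (n + indicator u)).adjoint h‖ ^ 2 := by
  have := norm_sq_wordMap Finset.univ (fun u : Finset (Fin k) => (-1 : ℝ) ^ u.card)
    (fun u => (V.tilde (indicator u)).adjoint) V.defectHom (V.norm_sq_defectHom hV)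
    (multiWord n) ((V.tilde n).adjoint h)
  simp only [norm_wordMap_tilde_adjoint] at this
  exact this

lemma sum_box_norm_sq_poissonCoord (hV : V.IsBrehmerSolel) (p : ℕ) (h : H) :
    ∑ n ∈ Fintype.piFinset fun _ : Fin k => Finset.range p, ‖V.poissonCoord n h‖ ^ 2
      = ∑ u : Finset (Fin k), (-1 : ℝ) ^ u.card * ‖(V.tildePow (indicator u) p).adjoint h‖ ^ 2 := by
  simp only [V.norm_sq_poissonCoord hV, norm_tildePow_adjoint]
  exact sum_box_alternating (fun n => ‖(V.tilde n).adjoint h‖ ^ 2) p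

lemma sum_box_norm_sq_poissonCoord_le (hV : V.IsBrehmerSolel) (p : ℕ) (h : H) :
    ∑ n ∈ Fintype.piFinset fun _ : Fin k => Finset.range p, ‖V.poissonCoord n h‖ ^ 2
      ≤ 2 ^ k * ‖h‖ ^ 2 := by
  -- There are `2ᵏ` terms, and the operators `Ṽ_{e(u)}^{*p}` are contractions.
  rw [V.sum_box_norm_sq_poissonCoord hV]
  have hle : ∀ u ∈ (Finset.univ : Finset (Finset (Fin k))),
      (-1 : ℝ) ^ u.card * ‖(V.tildePow (indicator u) p).adjoint h‖ ^ 2 ≤ ‖h‖ ^ 2 := fun u _ => by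
    rw [norm_tildePow_adjoint]
    have h1 : ‖(V.tilde (p • indicator u)).adjoint h‖ ^ 2 ≤ ‖h‖ ^ 2 :=
      pow_le_pow_left₀ (norm_nonneg _) ((V.contraction_tildeWord _).adjoint h) 2
    rcases neg_one_pow_eq_or ℝ u.card with h2 | h2 <;> rw [h2] <;> nlinarith [sq_nonneg ‖h‖,
      sq_nonneg ‖(V.tilde (p • indicator u)).adjoint h‖]
  refine (Finset.sum_le_card_nsmul _ _ _ hle).trans_eq ?_
  simp

lemma summable_norm_sq_poissonCoord (hV : V.IsBrehmerSolel) (h : H) :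
    Summable fun n => ‖V.poissonCoord n h‖ ^ 2 :=
  summable_of_sum_box_le (fun _ => by positivity) fun p => V.sum_box_norm_sq_poissonCoord_le hV p h

lemma tendsto_alternating (hV : V.IsBrehmerSolel) (h : H) :
    Tendsto (fun p : ℕ => ∑ u : Finset (Fin k), (-1 : ℝ) ^ u.card *
        ‖(V.tildePow (indicator u) p).adjoint h‖ ^ 2)
      atTop (𝓝 (∑' n, ‖V.poissonCoord n h‖ ^ 2)) := by
  have := (V.summable_norm_sq_poissonCoord hV h).hasSum.comp (tendsto_box k)
  refine this.congr fun p => ?_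
  exact V.sum_box_norm_sq_poissonCoord hV p h

/-- The Poisson kernel `h ↦ ((I_{E(n)} ⊗ Δ⋆(V)) Ṽ_n⋆ h)ₙ`. -/
noncomputable def poisson (hV : V.IsBrehmerSolel) : HilbRep.Hom H (𝔼.fock V.defectRep) where
  toCLM := LinearMap.mkContinuous
    (F := lp (fun n : Fin k → ℕ => 𝔼.word (multiWord n) V.defectRep) 2)
    { toFun := fun h => ⟨fun n => V.poissonCoord n h, memℓp_gen (by
        simpa using V.summable_norm_sq_poissonCoord hV h)⟩
      map_add' := fun g h => lp.ext (funext fun n => (V.poissonCoord n).toCLM.map_add g h)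
      map_smul' := fun r h => lp.ext (funext fun n => (V.poissonCoord n).toCLM.map_smul r h) }
    √(2 ^ k) fun h => by
      rw [← sq_le_sq₀ (norm_nonneg _) (by positivity), mul_pow, Real.sq_sqrt (by positivity),
        HilbRep.norm_sq_lp]
      refine le_of_tendsto' ((V.summable_norm_sq_poissonCoord hV h).hasSum.comp (tendsto_box k))
        fun p => V.sum_box_norm_sq_poissonCoord_le hV p h
  comm a h := lp.ext (funext fun n => (V.poissonCoord n).comm a h)

lemma norm_sq_poisson (hV : V.IsBrehmerSolel) (h : H) :
    ‖V.poisson hV h‖ ^ 2 = ∑' n, ‖V.poissonCoord n h‖ ^ 2 := HilbRep.norm_sq_lp _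

lemma poisson_adjoint_incl (hV : V.IsBrehmerSolel) (n : Fin k → ℕ)
    (x : 𝔼.word (multiWord n) V.defectRep) :
    (V.poisson hV).adjoint
        (HilbRep.incl (fun n : Fin k → ℕ => 𝔼.word (multiWord n) V.defectRep) n x)
      = (V.poissonCoord n).adjoint x := by
  refine ext_inner_right ℂ fun h => ?_
  refine ((V.poisson hV).adjoint_inner_left h _).trans
    (Eq.trans ?_ ((V.poissonCoord n).adjoint_inner_left h x).symm)
  exact lp.inner_single_left (𝕜 := ℂ) (G := fun n : Fin k → ℕ => 𝔼.word (multiWord n) V.defectRep)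
    n x (V.poisson hV h)

/-- The adjoint of the intertwining relation, restricted to the summand `E(n) ⊗ 𝓓⋆`. -/
lemma poissonCoord_adjoint_shiftMap (i : Fin k) (n : Fin k → ℕ) :
    (V.poissonCoord (n + Pi.single i 1)).adjoint.comp (𝔼.shiftMap i n V.defectRep)
      = (V.V i).tilde.comp ((𝔼.E i).lTensor (V.poissonCoord n).adjoint) := by
  simp only [poissonCoord, HilbRep.Hom.adjoint_comp, HilbRep.Hom.adjoint_adjoint,
    ← wordMap_adjoint]
  rw [HilbRep.Hom.comp_assoc, ← shiftMap_natural, ← HilbRep.Hom.comp_assoc, tilde_comp_shiftMap,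
    HilbRep.Hom.comp_assoc, ← CStarCorr.lTensor_comp]

end CCRep

lemma shift_incl (i : Fin k) (K : HilbRep.{w, u} B) (ξ : 𝔼.E i) (n : Fin k → ℕ)
    (x : 𝔼.word (multiWord n) K) :
    𝔼.shift i K ξ (HilbRep.incl (fun n : Fin k → ℕ => 𝔼.word (multiWord n) K) n x)
      = HilbRep.incl (fun n : Fin k → ℕ => 𝔼.word (multiWord n) K) (n + Pi.single i 1)
        (𝔼.shiftMap i n K ((𝔼.E i).tmulRep _ ξ x)) := by
  let G : (Fin k → ℕ) → HilbRep.{w, u} B := fun n => 𝔼.word (multiWord n) K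
  let s : (Fin k → ℕ) → (Fin k → ℕ) := fun n => n + Pi.single i 1
  have hs : Function.Injective s := add_left_injective _
  have e : CStarCorr.sumDiag G s (fun n => 𝔼.shiftMap i n K)
        (fun n => 𝔼.contraction_shiftMap i n K) ξ (HilbRep.incl G n x)
      = lp.single (E := fun n => G (s n)) 2 n (𝔼.shiftMap i n K ((𝔼.E i).tmulRep _ ξ x)) := by
    refine lp.ext (funext fun m => ?_)
    change (𝔼.shiftMap i m K).toCLM ((𝔼.E i).creation _ ξ (lp.single (E := fun n => G n) 2 n x m))
      = _
    by_cases h : m = n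
    · subst h
      rw [lp.single_apply_self, lp.single_apply_self]
      rfl
    · rw [lp.single_apply_ne _ _ _ h, lp.single_apply_ne _ _ _ h, map_zero, map_zero]
  change (HilbRep.orthogonalFamily_incl G s hs).linearIsometry
    (CStarCorr.sumDiag G s (fun n => 𝔼.shiftMap i n K)
        (fun n => 𝔼.contraction_shiftMap i n K) ξ (HilbRep.incl G n x)) = _
  rw [e]
  exact (HilbRep.orthogonalFamily_incl G s hs).linearIsometry_apply_single _

lemma shiftTilde_tmulRep (i : Fin k) (K : HilbRep.{w, u} B) (ξ : 𝔼.E i) (f : 𝔼.fock K) :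
    𝔼.shiftTilde i K ((𝔼.E i).tmulRep _ ξ f) = 𝔼.shift i K ξ f :=
  CStarCorr.liftHom_tmulRep _ _ _ ξ f

namespace CCRep

variable {H : HilbRep.{w, u} B} (V : 𝔼.CCRep H)

/-- The adjoint of the intertwining relation between `Ṽ⁽ⁱ⁾⋆` and `S̃⁽ⁱ⁾⋆`; it is checked on the
vectors `ξ ⊗ η` with `η` in one summand of the Fock space. -/
lemma poisson_adjoint_shiftTilde (hV : V.IsBrehmerSolel) (i : Fin k) :
    (V.poisson hV).adjoint.comp (𝔼.shiftTilde i V.defectRep)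
      = (V.V i).tilde.comp ((𝔼.E i).lTensor (V.poisson hV).adjoint) := by
  refine CStarCorr.hom_ext fun ξ f => ?_
  change (V.poisson hV).adjoint (𝔼.shiftTilde i V.defectRep ((𝔼.E i).tmulRep _ ξ f))
    = (V.V i).tilde ((𝔼.E i).lTensor (V.poisson hV).adjoint ((𝔼.E i).tmulRep _ ξ f))
  rw [CStarCorr.lTensor_tmulRep, shiftTilde_tmulRep]
  refine congrArg (fun g => g f) (lp.ext_continuousLinearMap (𝕜 := ℂ) (p := 2)
    (E := fun n : Fin k → ℕ => 𝔼.word (multiWord n) V.defectRep) ENNReal.ofNat_ne_top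
    (f := (V.poisson hV).adjoint.toCLM ∘L 𝔼.shift i V.defectRep ξ)
    (g := (V.V i).tilde.toCLM ∘L (𝔼.E i).creation H ξ ∘L (V.poisson hV).adjoint.toCLM)
    fun n => ContinuousLinearMap.ext fun x => ?_)
  change (V.poisson hV).adjoint (𝔼.shift i V.defectRep ξ
      (HilbRep.incl (fun n : Fin k → ℕ => 𝔼.word (multiWord n) V.defectRep) n x))
    = (V.V i).tilde ((𝔼.E i).tmulRep H ξ ((V.poisson hV).adjoint
      (HilbRep.incl (fun n : Fin k → ℕ => 𝔼.word (multiWord n) V.defectRep) n x)))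
  rw [shift_incl, poisson_adjoint_incl, poisson_adjoint_incl, ← CStarCorr.lTensor_tmulRep]
  exact congrArg (fun X : HilbRep.Hom _ _ => X ((𝔼.E i).tmulRep _ ξ x))
    (V.poissonCoord_adjoint_shiftMap i n)

lemma lTensor_poisson_tilde_adjoint (hV : V.IsBrehmerSolel) (i : Fin k) :
    ((𝔼.E i).lTensor (V.poisson hV)).comp (V.V i).tilde.adjoint
      = (𝔼.shiftTilde i V.defectRep).adjoint.comp (V.poisson hV) := by
  have h := congrArg HilbRep.Hom.adjoint (V.poisson_adjoint_shiftTilde hV i)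
  simp only [HilbRep.Hom.adjoint_comp, CStarCorr.lTensor_adjoint,
    HilbRep.Hom.adjoint_adjoint] at h
  exact h.symm

end CCRep

end ProductSystem

end BrehmerSolel

theorem mainTheorem2 {B : Type w} [NonUnitalCStarAlgebra B] [PartialOrder B] [StarOrderedRing B]
    {k : ℕ} (𝔼 : BrehmerSolel.ProductSystem.{w, u} B k) (H : BrehmerSolel.HilbRep.{w, u} B)
    (V : 𝔼.CCRep H) (hV : V.IsBrehmerSolel) :
    ∃ P : BrehmerSolel.HilbRep.Hom H (𝔼.fock V.defectRep),
      (∀ (n : Fin k → ℕ) (h : H),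
        BrehmerSolel.HilbRep.coord (P h) n
          = 𝔼.wordMap V.defectHom (BrehmerSolel.multiWord n) ((V.tilde n).adjoint h)) ∧
      (∀ (a : B) (h : H), P (H.rep a h) = (𝔼.fock V.defectRep).rep a (P h)) ∧
      (∀ i : Fin k, ((𝔼.E i).lTensor P).comp (V.V i).tilde.adjoint
        = (𝔼.shiftTilde i V.defectRep).adjoint.comp P) ∧
      ∀ h : H,
        Tendsto (fun p : ℕ => ∑ u : Finset (Fin k), (-1 : ℝ) ^ u.card *
            ‖(V.tildePow (BrehmerSolel.ProductSystem.indicator u) p).adjoint h‖ ^ 2)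
          atTop (𝓝 (‖P h‖ ^ 2)) ∧
        ∃ L : ℝ,
          Tendsto (fun p : ℕ => ∑ u ∈ Finset.univ.filter fun u : Finset (Fin k) => u ≠ ∅,
            (-1 : ℝ) ^ u.card *
              ‖(V.tildePow (BrehmerSolel.ProductSystem.indicator u) p).adjoint h‖ ^ 2)
            atTop (𝓝 L) ∧
          ‖P h‖ ^ 2 = ‖h‖ ^ 2 + L := by
  refine ⟨V.poisson hV, fun _ _ => rfl, (V.poisson hV).comm, V.lTensor_poisson_tilde_adjoint hV,
    fun h => ?_⟩
  have h1 := V.tendsto_alternating hV h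
  rw [← V.norm_sq_poisson hV] at h1
  refine ⟨h1, ‖V.poisson hV h‖ ^ 2 - ‖h‖ ^ 2, ?_, by ring⟩
  refine (h1.sub_const (‖h‖ ^ 2)).congr fun p => ?_
  have h0 : ‖(V.tildePow (BrehmerSolel.ProductSystem.indicator ∅) p).adjoint h‖ = ‖h‖ := by
    rw [V.norm_tildePow_adjoint]
    have : p • BrehmerSolel.ProductSystem.indicator (∅ : Finset (Fin k)) = 0 := by
      funext i
      simp [BrehmerSolel.ProductSystem.indicator]
    rw [this, V.norm_tilde_zero_adjoint]
  rw [Finset.filter_ne', ← Finset.add_sum_erase _ _ (Finset.mem_univ (∅ : Finset (Fin k))), h0]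
  simp
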